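/- Let $n\ge 0$ be an integer, $\tau>0$, let $A\in\mathbb R^{n\times n}$ be a matrix all of whose complex eigenvalues have negative real part, and let $Q\in\mathbb R^{n\times n}$ be symmetric positive definite. Let $(x,\eta)$ be a square-integrable stationary process in $\mathbb R^n\times\mathbb R^n$ on $[0,\infty)$ solving $$\frac{d}{dt}x=Ax+\sqrt{2Q}\,\eta,\qquad \frac{d}{dt}\eta=-\frac1\tau\eta+\frac1\tau\xi,$$ where $\xi=dW/dt$ is normalized white noise, i.e. $W$ is a standard $n$-dimensional Brownian motion independent of $(x(0),\eta(0))$ (so $\eta$ is a stationary Ornstein–Uhlenbeck coloured noise with correlation time $\tau$). Let $C=\langle x(t)x(t)^T\rangle$ be the stationary covariance and $K(s)=\langle x(t+s)x(t)^T\rangle$ ($s\in\mathbb R$, $t\ge\max(0,-s)$) the correlation function, where $\langle\cdot\rangle$ denotes expectation; both are independent of $t$. Then $I-\tau A$ is invertible, and with $B=(I-\tau A)^{-1}$ the generalized fluctuation–dissipation relation holds: $$0=AC+CA^T+QB^T+BQ.\tag{0}$$ The function $K$ is twice differentiable on $\mathbb R$, and $K''$ has a right derivative and a left derivative at $0$;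 write $K'''(0)$ for the mean of these two one-sided derivatives (the ordinary third derivative at $0$ need not exist). One has $$K'(0)=AC+QB^T=\tfrac12\big(AC-CA^T+QB^T-BQ\big),\tag{1}$$ $$K''(0)=\tfrac12\Big(A\big(K'(0)+\tfrac1\tau C\big)+\big(K'(0)^T+\tfrac1\tau C\big)A^T\Big),\tag{2}$$ $$K'''(0)=\tfrac1{\tau^2}K'(0)+\tfrac12\Big(A\big(K''(0)-\tfrac1{\tau^2}C\big)-\big(K''(0)-\tfrac1{\tau^2}C\big)A^T\Big).\tag{3}$$ The equations (0), (2), (3) characterize $A$ and $Q$: given $\tau$ and the data $C,K'(0),K''(0),K'''(0)$, the pair $(A,Q)$ is the only pair of real $n\times n$ matrices satisfying (0), (2) and (3), with $B$ in (0) formed from the unknown $A$. If moreover $A$ is negative definite (symmetric with strictly negative eigenvalues), then (0) and (2) suffice: $(A,Q)$ is the only pair of real $n\times n$ matrices with symmetric first component satisfying (0) and (2). Finally, if $n=1$, then $C\neq0$, $K'(0)=0$ and $K''(0)/C=A/\tau$. -/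

import Mathlib

open MeasureTheory ProbabilityTheory
open scoped NNReal Matrix MatrixOrder

noncomputable section

/-- Every (complex) eigenvalue of the real matrix `A` has negative real part. -/
def IsHurwitz {n : ℕ} (A : Matrix (Fin n) (Fin n) ℝ) : Prop :=
  ∀ z ∈ spectrum ℂ (A.map (algebraMap ℝ ℂ)), z.re < 0

/-- The matrix `B = (I - τ A)⁻¹`. -/
def noiseResolvent {n : ℕ} (τ : ℝ) (A : Matrix (Fin n) (Fin n) ℝ) : Matrix (Fin n) (Fin n) ℝ :=
  (1 - τ • A)⁻¹

/-- A standard `n`-dimensional Brownian motion: independent coordinates, each of which is a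
standard real Brownian motion. Its formal time derivative is the normalized white noise `ξ`. -/
structure IsBrownianVector {Ω : Type*} [MeasurableSpace Ω] (P : Measure Ω) {n : ℕ}
    (W : ℝ≥0 → Ω → Fin n → ℝ) : Prop where
  brownian : ∀ j, IsBrownianReal (fun t ω => W t ω j) P
  indep : iIndepFun (fun (j : Fin n) (ω : Ω) (t : ℝ≥0) => W t ω j) P

/-- `(x, η)` is a square integrable stationary solution on `[0, ∞)` of
`dx/dt = A x + √(2Q) η`, `dη/dt = -η/τ + ξ/τ`, where `ξ = dW/dt` is normalized white noise. -/
structure IsStationaryColoredNoiseProcess {Ω : Type*} [MeasurableSpace Ω] (P : Measure Ω) {n : ℕ}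
    (A Q : Matrix (Fin n) (Fin n) ℝ) (τ : ℝ) (x η W : ℝ≥0 → Ω → Fin n → ℝ) : Prop where
  measurable_x : ∀ t, Measurable (x t)
  measurable_noise : ∀ t, Measurable (η t)
  brownian : IsBrownianVector P W
  /-- The initial state is independent of the driving white noise. -/
  indep_init : IndepFun (fun ω => (x 0 ω, η 0 ω)) (fun ω (t : ℝ≥0) => W t ω) P
  continuous_noise : ∀ᵐ ω ∂P, Continuous (fun t => η t ω)
  /-- The noise equation, integrated over `[0, t]`. -/
  noise_eq : ∀ᵐ ω ∂P, ∀ t : ℝ≥0,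
    η t ω = η 0 ω - (1 / τ) • (∫ s in (0 : ℝ)..t, η s.toNNReal ω) + (1 / τ) • W t ω
  /-- The paths of `x` solve the (random) ordinary differential equation on `[0, ∞)`. -/
  state_eq : ∀ᵐ ω ∂P, ∀ t : ℝ≥0,
    HasDerivWithinAt (fun s : ℝ => x s.toNNReal ω)
      (A *ᵥ x t ω + CFC.sqrt ((2 : ℝ) • Q) *ᵥ η t ω) (Set.Ici 0) (t : ℝ)
  memLp_x : ∀ t, MemLp (x t) 2 P
  memLp_noise : ∀ t, MemLp (η t) 2 P
  /-- Strict stationarity: the law of the whole path is invariant under time shifts. -/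
  stationary : ∀ h : ℝ≥0,
    IdentDistrib (fun ω (t : ℝ≥0) => (x (t + h) ω, η (t + h) ω))
      (fun ω (t : ℝ≥0) => (x t ω, η t ω)) P P

/-- The two-time moment matrix `⟨x(s) x(t)ᵀ⟩`. -/
def twoTimeMoment {Ω : Type*} [MeasurableSpace Ω] (P : Measure Ω) {n : ℕ}
    (x : ℝ≥0 → Ω → Fin n → ℝ) (s t : ℝ≥0) : Matrix (Fin n) (Fin n) ℝ :=
  Matrix.of fun i j => ∫ ω, x s ω i * x t ω j ∂P

/-- The correlation function `K(s) = ⟨x(t + s) x(t)ᵀ⟩`, `s ∈ ℝ`, computed at the earliest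
admissible time `t = max(-s, 0)`. -/
def correlation {Ω : Type*} [MeasurableSpace Ω] (P : Measure Ω) {n : ℕ}
    (x : ℝ≥0 → Ω → Fin n → ℝ) (s : ℝ) : Matrix (Fin n) (Fin n) ℝ :=
  twoTimeMoment P x s.toNNReal (-s).toNNReal

/-- The stationary covariance `C = ⟨x(t) x(t)ᵀ⟩`, computed at time `t = 0`. -/
def stationaryCov {Ω : Type*} [MeasurableSpace Ω] (P : Measure Ω) {n : ℕ}
    (x : ℝ≥0 → Ω → Fin n → ℝ) : Matrix (Fin n) (Fin n) ℝ :=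
  twoTimeMoment P x 0 0

/-- The generalized fluctuation-dissipation relation. -/
def FluctuationDissipation {n : ℕ} (τ : ℝ) (A Q C : Matrix (Fin n) (Fin n) ℝ) : Prop :=
  0 = A * C + C * Aᵀ + Q * (noiseResolvent τ A)ᵀ + noiseResolvent τ A * Q

/-- The relation for the second derivative `K₂ = K''(0)`, where `K₁ = K'(0)`. -/
def SecondDerivRelation {n : ℕ} (τ : ℝ) (A C K₁ K₂ : Matrix (Fin n) (Fin n) ℝ) : Prop :=
  K₂ = (1 / 2 : ℝ) • (A * (K₁ + (1 / τ) • C) + (K₁ᵀ + (1 / τ) • C) * Aᵀ)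

/-- The relation for the third derivative `K₃ = K'''(0)`. -/
def ThirdDerivRelation {n : ℕ} (τ : ℝ) (A C K₁ K₂ K₃ : Matrix (Fin n) (Fin n) ℝ) : Prop :=
  K₃ = (1 / τ ^ 2) • K₁ +
    (1 / 2 : ℝ) • (A * (K₂ - (1 / τ ^ 2) • C) - (K₂ - (1 / τ ^ 2) • C) * Aᵀ)

/-- Entrywise derivative of a matrix-valued function within a set. -/
def HasMatrixDerivWithinAt {n : ℕ} (F : ℝ → Matrix (Fin n) (Fin n) ℝ)
    (D : Matrix (Fin n) (Fin n) ℝ) (S : Set ℝ) (s : ℝ) : Prop :=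
  ∀ i j, HasDerivWithinAt (fun u => F u i j) (D i j) S s

end

/-! No stochastic calculus is needed: the integrated equations are multiplied by a square-integrable
variable and averaged, so that only second moments remain. Independence of the initial state from
`W` makes `⟨η(t) v(z(0))⟩` decay like `exp (-t / τ)` for every functional `v` of the state `z = (x,
η)`, and stationarity turns this into a formula for any earlier state against later noise. Testing
the two equations against `η(1)` then gives `⟨η ηᵀ⟩ = I / (2τ)` and `⟨x ηᵀ⟩ = B √(2Q) / 2`. Hence
`K' = A K + exp (-s / τ) Q Bᵀ` for `s ≥ 0`, while `K(-s) = K(s)ᵀ` supplies negative times.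

Constancy of `⟨x xᵀ⟩` is relation (0), and says that `K'(0)` is antisymmetric. `K''(0)` is minus the
covariance of the velocity, hence symmetric. With `Q Bᵀ = K'(0) - A C`, the symmetric part of the
formula for `K''(0)` is (2), and the antisymmetric part of the right third derivative, which is the
mean of the two one-sided ones, is (3).

For uniqueness let `D = A' - A`, `F = K'(0) + C / τ` and `R = C / τ² - K''(0)`. Then (2) gives `D F
+ Fᵀ Dᵀ = 0` and (3) gives `D R = R Dᵀ`, where `R` and `F + Fᵀ` are positive definite. Conjugation
by `√R` makes `D` symmetric, and testing on its eigenvectors gives `D = 0`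
(`Matrix.PosDef.eq_zero_of_mul_eq_of_mul_add`). If `A` and `A'` are symmetric, so is `D`, and (3) is
not needed. With `A` known, (0) becomes a Lyapunov equation for `Q' - Q`
(`IsHurwitz.eq_zero_of_lyapunov`). -/

/-! ### Linear algebra behind uniqueness -/

/-- `A X = X D` forces `X = 0` when the spectra of `A` and `D` are disjoint. -/
theorem Matrix.eq_zero_of_mul_eq_mul_of_disjoint_spectrum {n : ℕ} {A D X : Matrix (Fin n) (Fin n) ℂ}
    (h : A * X = X * D) (hd : Disjoint (spectrum ℂ A) (spectrum ℂ D)) : X = 0 := by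
  -- The spectral mapping theorem used below needs a nonempty spectrum, so size zero is treated
  -- apart.
  rcases isEmpty_or_nonempty (Fin n) with hn | hn
  · ext i; exact hn.elim i
  have key : ∀ p : Polynomial ℂ, Polynomial.aeval A p * X = X * Polynomial.aeval D p := by
    intro p
    induction p using Polynomial.induction_on' with
    | add p q hp hq => rw [map_add, map_add, add_mul, mul_add, hp, hq]
    | monomial k a =>
      have hk : ∀ k : ℕ, A ^ k * X = X * D ^ k := by
        intro k
        induction k with
        | zero => simp
        | succ k ih => rw [pow_succ, mul_assoc, h, ← mul_assoc, ih, mul_assoc, ← pow_succ]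
      rw [Polynomial.aeval_monomial, Polynomial.aeval_monomial, mul_assoc, hk,
        Algebra.left_comm]
  -- Cayley–Hamilton kills the left side, and `χ_A(D)` is invertible because no eigenvalue of `D` is
  -- a root of `χ_A`.
  have h0 := key A.charpoly
  rw [Matrix.aeval_self_charpoly, zero_mul] at h0
  have hu : IsUnit (Polynomial.aeval D A.charpoly) := by
    rw [← spectrum.zero_notMem_iff ℂ,
      spectrum.map_polynomial_aeval_of_nonempty D _ (spectrum.nonempty_of_isAlgClosed_of_finiteDimensional ℂ D)]
    rintro ⟨z, hz, hz0⟩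
    exact Set.disjoint_left.1 hd (Matrix.mem_spectrum_of_isRoot_charpoly hz0) hz
  exact (hu.mul_left_eq_zero).1 h0.symm

theorem Matrix.spectrum_transpose {n : ℕ} (A : Matrix (Fin n) (Fin n) ℂ) :
    spectrum ℂ Aᵀ = spectrum ℂ A := by
  ext z
  rw [Matrix.mem_spectrum_iff_isRoot_charpoly, Matrix.mem_spectrum_iff_isRoot_charpoly,
    Matrix.charpoly_transpose]

/-- The positive number `1 / τ` cannot be an eigenvalue of `A`. -/
theorem IsHurwitz.isUnit_one_sub_smul {n : ℕ} {A : Matrix (Fin n) (Fin n) ℝ} (hA : IsHurwitz A)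
    {τ : ℝ} (hτ : 0 < τ) : IsUnit (1 - τ • A) := by
  have h : ((1 / τ : ℝ) : ℂ) ∉ spectrum ℂ (A.map (algebraMap ℝ ℂ)) := by
    intro h
    have := hA _ h
    rw [Complex.ofReal_re] at this
    exact absurd this (not_lt.2 (by positivity))
  rw [spectrum.notMem_iff, Matrix.isUnit_iff_isUnit_det] at h
  rw [Matrix.isUnit_iff_isUnit_det]
  have e : algebraMap ℂ (Matrix (Fin n) (Fin n) ℂ) ((1 / τ : ℝ) : ℂ) - A.map (algebraMap ℝ ℂ)
      = (algebraMap ℝ ℂ).mapMatrix ((1 / τ) • (1 - τ • A)) := by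
    ext i j
    by_cases hij : i = j
    · subst hij
      have : (τ : ℂ) ≠ 0 := by exact_mod_cast hτ.ne'
      simp [Matrix.algebraMap_matrix_apply]
      field_simp
    · have : (τ : ℂ) ≠ 0 := by exact_mod_cast hτ.ne'
      simp [Matrix.algebraMap_matrix_apply, hij]
      field_simp
  rw [e, ← RingHom.map_det, isUnit_iff_ne_zero, Matrix.det_smul] at h
  rw [isUnit_iff_ne_zero]
  rintro h0
  exact h (by simp [h0])

/-- A Lyapunov equation with matrix `1 - τ A`, where `A` is Hurwitz, has only the trivial
solution. -/
theorem IsHurwitz.eq_zero_of_lyapunov {n : ℕ} {A X : Matrix (Fin n) (Fin n) ℝ} (hA : IsHurwitz A)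
    {τ : ℝ} (hτ : 0 < τ) (h : (1 - τ • A) * X + X * (1 - τ • A)ᵀ = 0) : X = 0 := by
  -- In this Sylvester form the spectra are disjoint: real parts are negative for `A` and exceed `2
  -- / τ` for `2 / τ - Aᵀ`.
  have h1 : A * X = X * ((2 / τ) • (1 : Matrix (Fin n) (Fin n) ℝ) - Aᵀ) := by
    have h2 : τ • (A * X) = τ • (X * ((2 / τ) • (1 : Matrix (Fin n) (Fin n) ℝ) - Aᵀ)) := by
      rw [mul_sub, smul_sub, Matrix.mul_smul, smul_smul, mul_div_cancel₀ _ hτ.ne', mul_one]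
      rw [Matrix.transpose_sub, Matrix.transpose_smul, Matrix.transpose_one, sub_mul, mul_sub,
        one_mul, mul_one, smul_mul_assoc, mul_smul_comm] at h
      rw [two_smul]
      rw [← sub_eq_zero, ← neg_eq_zero, ← h]
      abel
    exact smul_right_injective _ hτ.ne' h2
  set f := (algebraMap ℝ ℂ).mapMatrix (m := Fin n)
  have h3 : f A * f X = f X * (algebraMap ℂ _ ((2 / τ : ℝ) : ℂ) - (f A)ᵀ) := by
    rw [← map_mul, h1, map_mul]
    congr 1
    ext i j
    by_cases hij : i = j
    · subst hij; simp [f, Matrix.algebraMap_matrix_apply]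
    · simp [f, Matrix.algebraMap_matrix_apply, hij]
  have h4 : f X = 0 := by
    refine Matrix.eq_zero_of_mul_eq_mul_of_disjoint_spectrum h3 (Set.disjoint_left.2 ?_)
    intro z hz hz'
    rw [← spectrum.singleton_sub_eq, Matrix.spectrum_transpose] at hz'
    obtain ⟨_, rfl, w, hw, rfl⟩ := Set.mem_sub.1 hz'
    have e1 := hA _ hz
    have e2 := hA _ hw
    have e3 : 0 < 2 / τ := by positivity
    simp only [Complex.sub_re, Complex.ofReal_re] at e1
    linarith
  ext i j
  have := congrFun (congrFun h4 i) j
  simpa [f] using this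

/-- A real symmetric matrix `T` with `T F + Fᵀ T = 0`, where `F` has positive definite symmetric
part, vanishes. -/
theorem Matrix.IsSymm.eq_zero_of_mul_add {n : ℕ} {T F : Matrix (Fin n) (Fin n) ℝ} (hT : T.IsSymm)
    (hF : (F + Fᵀ).PosDef) (h : T * F + Fᵀ * T = 0) : T = 0 := by
  have hH : T.IsHermitian := by rwa [Matrix.IsHermitian, Matrix.conjTranspose_eq_transpose_of_trivial]
  rw [← hH.eigenvalues_eq_zero_iff]
  funext i
  set u : Fin n → ℝ := (hH.eigenvectorBasis i).ofLp
  have hu : T *ᵥ u = hH.eigenvalues i • u := hH.mulVec_eigenvectorBasis i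
  have hu0 : u ≠ 0 := by
    intro h0
    have := hH.eigenvectorBasis.orthonormal.ne_zero i
    exact this (by ext k; exact congrFun h0 k)
  have hpos := hF.dotProduct_mulVec_pos hu0
  -- For an eigenvector `u` of `T` with eigenvalue `λ`, the hypothesis reads `λ * (u ⬝ᵥ (F + Fᵀ) *ᵥ
  -- u) = 0`.
  have e := congrArg (fun Z => u ⬝ᵥ Z *ᵥ u) h
  simp only [Matrix.add_mulVec, dotProduct_add, ← Matrix.mulVec_mulVec, hu, Matrix.mulVec_smul,
    Matrix.zero_mulVec, dotProduct_zero, dotProduct_smul] at e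
  rw [Matrix.dotProduct_mulVec u T, ← Matrix.mulVec_transpose, hT.eq, hu, smul_dotProduct] at e
  rw [star_trivial, Matrix.add_mulVec, dotProduct_add] at hpos
  simp only [smul_eq_mul, ← mul_add] at e
  exact (mul_eq_zero.1 e).resolve_right hpos.ne'

/-- A matrix `D` which is self-adjoint for the inner product of a positive definite `R`, and for
which `D F` is antisymmetric where `F` has positive definite symmetric part, vanishes. -/
theorem Matrix.PosDef.eq_zero_of_mul_eq_of_mul_add {n : ℕ} {R D F : Matrix (Fin n) (Fin n) ℝ}
    (hR : R.PosDef) (hF : (F + Fᵀ).PosDef) (h₁ : D * R = R * Dᵀ) (h₂ : D * F + Fᵀ * Dᵀ = 0) :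
    D = 0 := by
  set B := CFC.sqrt R
  have hBB : B * B = R := CFC.sqrt_mul_sqrt_self R hR.posSemidef.nonneg
  have hBs : Bᵀ = B := by
    have := (Matrix.nonneg_iff_posSemidef.1 (CFC.sqrt_nonneg R)).isHermitian
    rwa [Matrix.IsHermitian, Matrix.conjTranspose_eq_transpose_of_trivial] at this
  have hBu : IsUnit B.det := by
    have := (Matrix.isUnit_iff_isUnit_det _).1 hR.isUnit
    rw [← hBB, Matrix.det_mul] at this
    exact isUnit_of_mul_isUnit_left this
  have hB1 : B * B⁻¹ = 1 := Matrix.mul_nonsing_inv _ hBu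
  have hB2 : B⁻¹ * B = 1 := Matrix.nonsing_inv_mul _ hBu
  have hBis : (B⁻¹)ᵀ = B⁻¹ := by rw [Matrix.transpose_nonsing_inv, hBs]
  have hT : (B⁻¹ * D * B).IsSymm := by
    rw [Matrix.IsSymm, Matrix.transpose_mul, Matrix.transpose_mul, hBis, hBs]
    calc B * (Dᵀ * B⁻¹) = B⁻¹ * (B * B * Dᵀ) * B⁻¹ := by
          simp only [← mul_assoc, hB2, one_mul]
      _ = B⁻¹ * D * B := by
          rw [hBB, ← h₁, ← hBB]
          simp only [mul_assoc, hB1, mul_one]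
  have hT0 : B⁻¹ * D * B = 0 := by
    -- Under `D ↦ B⁻¹ D B` the matching change of `F` is a congruence, which preserves positive
    -- definiteness of the symmetric part.
    refine hT.eq_zero_of_mul_add (F := B⁻¹ * F * B⁻¹) ?_ ?_
    · have := hF.conjTranspose_mul_mul_same (B := B⁻¹)
        (Matrix.mulVec_injective_of_isUnit ((Matrix.isUnit_iff_isUnit_det _).2
          (Matrix.isUnit_nonsing_inv_det _ hBu)))
      rw [Matrix.conjTranspose_eq_transpose_of_trivial, hBis] at this
      convert this using 1
      rw [Matrix.transpose_mul, Matrix.transpose_mul, hBis]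
      noncomm_ring
    · have e : B⁻¹ * D * B = B * Dᵀ * B⁻¹ := by
        have := hT.eq
        rw [Matrix.transpose_mul, Matrix.transpose_mul, hBis, hBs] at this
        rw [← this, mul_assoc]
      calc B⁻¹ * D * B * (B⁻¹ * F * B⁻¹) + (B⁻¹ * F * B⁻¹)ᵀ * (B⁻¹ * D * B)
          = B⁻¹ * D * (B * B⁻¹) * F * B⁻¹ + B⁻¹ * Fᵀ * (B⁻¹ * B) * Dᵀ * B⁻¹ := by
            rw [Matrix.transpose_mul, Matrix.transpose_mul, hBis]
            nth_rw 2 [e]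
            noncomm_ring
        _ = B⁻¹ * (D * F + Fᵀ * Dᵀ) * B⁻¹ := by rw [hB1, hB2]; noncomm_ring
        _ = 0 := by rw [h₂]; simp
  calc D = B * (B⁻¹ * D * B) * B⁻¹ := by
        simp only [mul_assoc, hB1, mul_one]
        rw [← mul_assoc, hB1, one_mul]
    _ = 0 := by rw [hT0]; simp

/-! ### Fubini and one-variable calculus -/

/-- Fubini's theorem for the time integral of a process with almost surely continuous paths. -/
theorem integral_intervalIntegral_mul_of_continuous {Ω : Type*} [MeasurableSpace Ω] {P : Measure Ω}
    [IsProbabilityMeasure P] {Y : ℝ → Ω → ℝ} {Z : Ω → ℝ} (hY : ∀ s, Measurable (Y s))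
    (hc : ∀ᵐ ω ∂P, Continuous fun s => Y s ω) (hZ : AEStronglyMeasurable Z P)
    (hi : ∀ s, Integrable (fun ω => Y s ω * Z ω) P) {c : ℝ}
    (hb : ∀ s, ∫ ω, ‖Y s ω * Z ω‖ ∂P ≤ c) (a b : ℝ) :
    IntervalIntegrable (fun s => ∫ ω, Y s ω * Z ω ∂P) volume a b ∧
    Integrable (fun ω => (∫ s in a..b, Y s ω) * Z ω) P ∧
    ∫ ω, (∫ s in a..b, Y s ω) * Z ω ∂P = ∫ s in a..b, ∫ ω, Y s ω * Z ω ∂P := by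
  classical
  -- Cutting off to a measurable set of full measure on which every path is continuous gives a
  -- jointly measurable version `V` of `Y`.
  obtain ⟨G, hGP, hGm, hGc⟩ : ∃ G : Set Ω, (∀ᵐ ω ∂P, ω ∈ G) ∧ MeasurableSet G ∧
      ∀ ω ∈ G, Continuous fun s => Y s ω := by
    refine ⟨(toMeasurable P {ω | ¬ Continuous fun s => Y s ω})ᶜ, ?_,
      (measurableSet_toMeasurable _ _).compl, fun ω hω => ?_⟩
    · rw [ae_iff]
      simp only [Set.mem_compl_iff, not_not, Set.ofPred_mem_eq, measure_toMeasurable]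
      exact hc
    · by_contra h
      exact hω (subset_toMeasurable _ _ h)
  set V : ℝ → Ω → ℝ := fun s => G.indicator (Y s)
  have hVY : ∀ᵐ ω ∂P, ∀ s, V s ω = Y s ω := by
    filter_upwards [hGP] with ω hω s
    exact Set.indicator_of_mem hω _
  have hVm : Measurable (Function.uncurry V) := by
    have : Measurable (Function.uncurry fun ω s => V s ω) := by
      refine Measurable.comp (g := Function.uncurry V) ?_ measurable_swap |>.comp measurable_id
      refine measurable_uncurry_of_continuous_of_measurable (u := V) (fun ω => ?_)
        fun s => (hY s).indicator hGm
      by_cases hω : ω ∈ G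
      · simpa [V, hω] using hGc ω hω
      · simpa [V, hω] using continuous_const
    exact this.comp measurable_swap
  set μ := (volume : Measure ℝ).restrict (Set.uIoc a b)
  have hμ : IsFiniteMeasure μ := ⟨by simp [μ, Set.uIoc]⟩
  have hint : Integrable (Function.uncurry fun s ω => V s ω * Z ω) (μ.prod P) := by
    have hsm : AEStronglyMeasurable (Function.uncurry fun s ω => V s ω * Z ω) (μ.prod P) :=
      hVm.aestronglyMeasurable.mul hZ.comp_snd
    rw [integrable_prod_iff hsm]
    have e : ∀ s, (fun ω => V s ω * Z ω) =ᵐ[P] fun ω => Y s ω * Z ω := fun s => by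
      filter_upwards [hVY] with ω hω
      rw [hω]
    refine ⟨Filter.Eventually.of_forall fun s => (hi s).congr (e s).symm, ?_⟩
    refine Integrable.of_bound hsm.norm.integral_prod_right' c
      (Filter.Eventually.of_forall fun s => ?_)
    rw [Real.norm_of_nonneg (integral_nonneg fun _ => norm_nonneg _)]
    refine le_trans (le_of_eq (integral_congr_ae ?_)) (hb s)
    filter_upwards [hVY] with ω hω
    simp only [Function.uncurry, hω]
  have e1 : ∀ s, ∫ ω, V s ω * Z ω ∂P = ∫ ω, Y s ω * Z ω ∂P := fun s => by
    refine integral_congr_ae ?_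
    filter_upwards [hVY] with ω hω
    rw [hω]
  have e2 : (fun ω => ∫ s in a..b, V s ω * Z ω) =ᵐ[P] fun ω => (∫ s in a..b, Y s ω) * Z ω := by
    filter_upwards [hVY] with ω hω
    simp only [hω, intervalIntegral.integral_mul_const]
  refine ⟨?_, ?_, ?_⟩
  · rw [intervalIntegrable_iff]
    simpa only [IntegrableOn, Function.uncurry, e1] using hint.integral_prod_left
  · refine Integrable.congr ?_ e2
    simp only [intervalIntegral.intervalIntegral_eq_integral_uIoc]
    exact hint.integral_prod_right.smul (if a ≤ b then (1 : ℝ) else -1)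
  · rw [← integral_congr_ae e2]
    simp only [intervalIntegral.intervalIntegral_eq_integral_uIoc, ← e1]
    rw [integral_smul, integral_integral_swap hint]

/-- Fubini only yields integrable moments; the integral equation upgrades them to continuous ones.
-/
theorem continuousOn_of_eq_add_integral {g f : ℝ → ℝ} {T a : ℝ} (hT : 0 ≤ T)
    (hf : IntervalIntegrable f volume 0 T)
    (h : ∀ s ∈ Set.Icc 0 T, g s = a + ∫ u in (0 : ℝ)..s, f u) : ContinuousOn g (Set.Icc 0 T) := by
  have : ContinuousOn (fun s => a + ∫ u in (0 : ℝ)..s, f u) (Set.Icc 0 T) := by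
    refine continuousOn_const.add ?_
    rw [← Set.uIcc_of_le hT]
    exact intervalIntegral.continuousOn_primitive_interval
      (by rwa [← intervalIntegrable_iff'])
  exact this.congr h

theorem hasDerivWithinAt_of_eq_add_integral {g f : ℝ → ℝ} {a : ℝ}
    (hf : ContinuousOn f (Set.Ici 0))
    (h : ∀ s ∈ Set.Ici (0 : ℝ), g s = a + ∫ u in (0 : ℝ)..s, f u) {s : ℝ} (hs : 0 ≤ s) :
    HasDerivWithinAt g (f s) (Set.Ici 0) s := by
  -- Freezing `f` to the left of `0` gives a function continuous on the whole line, so the two-sided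
  -- fundamental theorem applies.
  set F : ℝ → ℝ := fun u => f (max u 0)
  have hF : Continuous F := hf.comp_continuous (by fun_prop) fun u => Set.mem_Ici.2 (le_max_right _ _)
  have h1 : HasDerivAt (fun s => a + ∫ u in (0 : ℝ)..s, F u) (F s) s :=
    (intervalIntegral.integral_hasDerivAt_right (hF.intervalIntegrable _ _)
      (hF.stronglyMeasurableAtFilter _ _) hF.continuousAt).const_add a
  have e : F s = f s := by simp [F, hs]
  rw [← e]
  refine h1.hasDerivWithinAt.congr (fun t ht => ?_) ?_
  · rw [h t ht]
    congr 1
    refine intervalIntegral.integral_congr fun u hu => ?_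
    rw [Set.uIcc_of_le ht] at hu
    simp [F, hu.1]
  · rw [h s hs]
    congr 1
    refine intervalIntegral.integral_congr fun u hu => ?_
    rw [Set.uIcc_of_le hs] at hu
    simp [F, hu.1]

/-- The integrated linear relaxation equation. -/
theorem eq_of_relaxation_eq {g : ℝ → ℝ} {τ T a b : ℝ} (hT : 0 ≤ T)
    (hg : IntervalIntegrable g volume 0 T)
    (h : ∀ s ∈ Set.Icc 0 T, g s = a - (1 / τ) * (∫ u in (0 : ℝ)..s, g u) + (1 / τ) * (b * s)) :
    g T = b + (a - b) * Real.exp (-T / τ) := by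
  have h' : ∀ s ∈ Set.Icc 0 T, g s = a + ∫ u in (0 : ℝ)..s, (-(1 / τ) * g u + b / τ) := by
    intro s hs
    have hi : IntervalIntegrable g volume 0 s :=
      hg.mono_set (by rw [Set.uIcc_of_le hs.1, Set.uIcc_of_le hT]; exact Set.Icc_subset_Icc_right hs.2)
    rw [h s hs, intervalIntegral.integral_add (hi.const_mul _) (by simp),
      intervalIntegral.integral_const_mul, intervalIntegral.integral_const, smul_eq_mul]
    ring
  have hgc : ContinuousOn g (Set.Icc 0 T) :=
    continuousOn_of_eq_add_integral hT ((hg.const_mul _).add (by simp)) h'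
  set F : ℝ → ℝ := fun u => -(1 / τ) * g (max 0 (min u T)) + b / τ
  have hF : Continuous F := by
    refine Continuous.add (Continuous.mul continuous_const ?_) continuous_const
    exact hgc.comp_continuous (by fun_prop)
      fun u => ⟨le_max_left _ _, max_le hT (min_le_right _ _)⟩
  set f : ℝ → ℝ := fun s => a + ∫ u in (0 : ℝ)..s, F u
  have hf : ∀ s, HasDerivAt f (F s) s := fun s =>
    (intervalIntegral.integral_hasDerivAt_right (hF.intervalIntegrable _ _)
      (hF.stronglyMeasurableAtFilter _ _) hF.continuousAt).const_add a
  have hgf : ∀ s ∈ Set.Icc 0 T, g s = f s := by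
    intro s hs
    rw [h' s hs]
    congr 1
    refine intervalIntegral.integral_congr fun u hu => ?_
    rw [Set.uIcc_of_le hs.1] at hu
    simp [F, min_eq_left (hu.2.trans hs.2), hu.1]
  -- Integrating factor: this product is constant on `[0, T]`.
  have hder : ∀ s, HasDerivAt (fun s => Real.exp (s / τ) * (f s - b))
      (Real.exp (s / τ) * (1 / τ) * (f s - b) + Real.exp (s / τ) * F s) s := fun s =>
    (((hasDerivAt_id s).div_const τ).exp).mul ((hf s).sub_const b)
  have hcon : Real.exp (T / τ) * (f T - b) = Real.exp (0 / τ) * (f 0 - b) := by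
    refine constant_of_has_deriv_right_zero (f := fun s => Real.exp (s / τ) * (f s - b))
      (fun s _ => (hder s).continuousAt.continuousWithinAt) (fun s hs => ?_) T ⟨hT, le_rfl⟩
    have hs' : s ∈ Set.Icc 0 T := ⟨hs.1, hs.2.le⟩
    have e : Real.exp (s / τ) * (1 / τ) * (f s - b) + Real.exp (s / τ) * F s = 0 := by
      simp only [F, min_eq_left hs'.2, max_eq_right hs'.1, hgf s hs']
      ring
    rw [← e]
    exact (hder s).hasDerivWithinAt
  have hf0 : f 0 = a := by simp [f]
  rw [hgf T ⟨hT, le_rfl⟩]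
  rw [zero_div, Real.exp_zero, hf0, one_mul] at hcon
  rw [neg_div, Real.exp_neg]
  have := Real.exp_pos (T / τ)
  field_simp
  linarith

theorem HasDerivWithinAt.comp_neg_Iic {g : ℝ → ℝ} {g' s : ℝ}
    (h : HasDerivWithinAt g g' (Set.Ici 0) (-s)) :
    HasDerivWithinAt (fun u => g (-u)) (-g') (Set.Iic 0) s := by
  have h1 := h.scomp s (hasDerivAt_neg s).hasDerivWithinAt
    (s := Set.Iic 0) (fun u hu => Set.mem_Ici.2 (neg_nonneg.2 hu))
  rw [neg_one_smul] at h1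
  exact h1

/-- Gluing a function on `[0, ∞)` with the reflection of another one. -/
theorem hasDerivAt_reflect {h g h' g' : ℝ → ℝ} {ε : ℝ}
    (hh : ∀ s, 0 ≤ s → HasDerivWithinAt h (h' s) (Set.Ici 0) s)
    (hg : ∀ s, 0 ≤ s → HasDerivWithinAt g (g' s) (Set.Ici 0) s)
    (h0 : h 0 = ε * g 0) (h0' : h' 0 = -ε * g' 0) (s : ℝ) :
    HasDerivAt (fun u => if 0 ≤ u then h u else ε * g (-u))
      (if 0 ≤ s then h' s else -ε * g' (-s)) s := by
  have hL : ∀ s ≤ 0, HasDerivWithinAt (fun u => ε * g (-u)) (-ε * g' (-s)) (Set.Iic 0) s := by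
    intro s hs
    rw [neg_mul, ← mul_neg]
    exact (hg (-s) (by linarith)).comp_neg_Iic.const_mul ε
  rcases lt_trichotomy s 0 with hs | rfl | hs
  · rw [if_neg hs.not_ge]
    refine ((hL s hs.le).hasDerivAt (Iic_mem_nhds hs)).congr_of_eventuallyEq ?_
    filter_upwards [Iio_mem_nhds hs] with u hu
    rw [if_neg (not_le.2 hu)]
  · rw [if_pos le_rfl, ← hasDerivWithinAt_univ, ← Set.Iic_union_Ici (a := (0 : ℝ))]
    refine HasDerivWithinAt.union ?_ ?_
    · have := hL 0 le_rfl
      rw [neg_zero, ← h0'] at this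
      refine this.congr (fun u hu => ?_) (by simp [h0])
      split_ifs with hu'
      · have : u = 0 := le_antisymm hu hu'
        simp [this, h0]
      · rfl
    · exact (hh 0 le_rfl).congr (fun u hu => if_pos hu) (by simp)
  · rw [if_pos hs.le]
    refine ((hh s hs.le).hasDerivAt (Ici_mem_nhds hs)).congr_of_eventuallyEq ?_
    filter_upwards [Ioi_mem_nhds hs] with u hu
    rw [if_pos (le_of_lt hu)]

/-! ### State functionals, their moments and the pathwise equations -/

/-- The space of states `(x, η)`. -/
abbrev PhaseSpace (n : ℕ) := (Fin n → ℝ) × (Fin n → ℝ)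

/-- The coordinate `xᵢ` of the state. -/
def posCoord {n : ℕ} (i : Fin n) : PhaseSpace n →L[ℝ] ℝ :=
  (ContinuousLinearMap.proj i).comp (ContinuousLinearMap.fst ℝ _ _)

/-- The coordinate `ηᵢ` of the state. -/
def noiseCoord {n : ℕ} (i : Fin n) : PhaseSpace n →L[ℝ] ℝ :=
  (ContinuousLinearMap.proj i).comp (ContinuousLinearMap.snd ℝ _ _)

/-- The `i`th component of `A x + S η`. -/
def driftCoord {n : ℕ} (A S : Matrix (Fin n) (Fin n) ℝ) (i : Fin n) : PhaseSpace n →L[ℝ] ℝ :=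
  ∑ l, A i l • posCoord l + ∑ l, S i l • noiseCoord l

@[simp] theorem posCoord_apply {n : ℕ} (i : Fin n) (z : PhaseSpace n) : posCoord i z = z.1 i := rfl

@[simp] theorem noiseCoord_apply {n : ℕ} (i : Fin n) (z : PhaseSpace n) :
    noiseCoord i z = z.2 i := rfl

theorem driftCoord_apply {n : ℕ} (A S : Matrix (Fin n) (Fin n) ℝ) (i : Fin n) (z : PhaseSpace n) :
    driftCoord A S i z = (A *ᵥ z.1 + S *ᵥ z.2) i := by
  simp [driftCoord, Matrix.mulVec, dotProduct]

/-- The moment `⟨u(z(s)) v(z(t))⟩` of the state process `z = (x, η)`. -/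
noncomputable def stateMoment {Ω : Type*} [MeasurableSpace Ω] (P : Measure Ω) {n : ℕ}
    (x η : ℝ≥0 → Ω → Fin n → ℝ) (u v : PhaseSpace n →L[ℝ] ℝ) (s t : ℝ≥0) : ℝ :=
  ∫ ω, u (x s ω, η s ω) * v (x t ω, η t ω) ∂P

theorem stateMoment_comm {Ω : Type*} [MeasurableSpace Ω] (P : Measure Ω) {n : ℕ}
    (x η : ℝ≥0 → Ω → Fin n → ℝ) (u v : PhaseSpace n →L[ℝ] ℝ) (s t : ℝ≥0) :
    stateMoment P x η u v s t = stateMoment P x η v u t s := by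
  simp only [stateMoment, mul_comm]

namespace IsStationaryColoredNoiseProcess

variable {Ω : Type*} [MeasurableSpace Ω] {P : Measure Ω} {n : ℕ}
  {A Q : Matrix (Fin n) (Fin n) ℝ} {τ : ℝ} {x η W : ℝ≥0 → Ω → Fin n → ℝ}

theorem measurable_state (hx : IsStationaryColoredNoiseProcess P A Q τ x η W)
    (u : PhaseSpace n →L[ℝ] ℝ) (t : ℝ≥0) : Measurable fun ω => u (x t ω, η t ω) :=
  u.continuous.measurable.comp ((hx.measurable_x t).prodMk (hx.measurable_noise t))

theorem memLp_state (hx : IsStationaryColoredNoiseProcess P A Q τ x η W)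
    (u : PhaseSpace n →L[ℝ] ℝ) (t : ℝ≥0) : MemLp (fun ω => u (x t ω, η t ω)) 2 P := by
  have h1 := (u.comp (ContinuousLinearMap.inl ℝ _ _)).comp_memLp' (hx.memLp_x t)
  have h2 := (u.comp (ContinuousLinearMap.inr ℝ _ _)).comp_memLp' (hx.memLp_noise t)
  refine (h1.add h2).ae_eq (Filter.Eventually.of_forall fun ω => ?_)
  simp [← map_add]

theorem integrable_mul (hx : IsStationaryColoredNoiseProcess P A Q τ x η W)
    (u v : PhaseSpace n →L[ℝ] ℝ) (s t : ℝ≥0) :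
    Integrable (fun ω => u (x s ω, η s ω) * v (x t ω, η t ω)) P :=
  (hx.memLp_state u s).integrable_mul (hx.memLp_state v t)

theorem stateMoment_add_left (hx : IsStationaryColoredNoiseProcess P A Q τ x η W)
    (u u' v : PhaseSpace n →L[ℝ] ℝ) (s t : ℝ≥0) :
    stateMoment P x η (u + u') v s t = stateMoment P x η u v s t + stateMoment P x η u' v s t := by
  simp only [stateMoment, _root_.add_apply, add_mul]
  exact integral_add (hx.integrable_mul u v s t) (hx.integrable_mul u' v s t)

theorem stateMoment_sum_left (hx : IsStationaryColoredNoiseProcess P A Q τ x η W)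
    (c : Fin n → ℝ) (u : Fin n → PhaseSpace n →L[ℝ] ℝ) (v : PhaseSpace n →L[ℝ] ℝ) (s t : ℝ≥0) :
    stateMoment P x η (∑ l, c l • u l) v s t = ∑ l, c l * stateMoment P x η (u l) v s t := by
  simp only [stateMoment, _root_.sum_apply, _root_.smul_apply,
    Finset.sum_mul, smul_eq_mul, mul_assoc]
  rw [integral_finsetSum _ fun l _ => (hx.integrable_mul (u l) v s t).const_mul _]
  simp only [integral_const_mul]

theorem stateMoment_drift_left (hx : IsStationaryColoredNoiseProcess P A Q τ x η W)
    (A' S' : Matrix (Fin n) (Fin n) ℝ) (i : Fin n) (v : PhaseSpace n →L[ℝ] ℝ) (s t : ℝ≥0) :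
    stateMoment P x η (driftCoord A' S' i) v s t =
      ∑ l, A' i l * stateMoment P x η (posCoord l) v s t +
      ∑ l, S' i l * stateMoment P x η (noiseCoord l) v s t := by
  rw [driftCoord, hx.stateMoment_add_left, hx.stateMoment_sum_left, hx.stateMoment_sum_left]

theorem stateMoment_add_add (hx : IsStationaryColoredNoiseProcess P A Q τ x η W)
    (u v : PhaseSpace n →L[ℝ] ℝ) (s t h : ℝ≥0) :
    stateMoment P x η u v (s + h) (t + h) = stateMoment P x η u v s t := by
  have hm : Measurable fun p : ℝ≥0 → PhaseSpace n => u (p s) * v (p t) :=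
    (u.continuous.measurable.comp (measurable_pi_apply s)).mul
      (v.continuous.measurable.comp (measurable_pi_apply t))
  exact ((hx.stationary h).comp hm).integral_eq

theorem stateMoment_eq_of_le (hx : IsStationaryColoredNoiseProcess P A Q τ x η W)
    (u v : PhaseSpace n →L[ℝ] ℝ) {s t : ℝ≥0} (h : s ≤ t) :
    stateMoment P x η u v s t = stateMoment P x η u v 0 (t - s) := by
  rw [← hx.stateMoment_add_add u v 0 (t - s) s, zero_add, tsub_add_cancel_of_le h]

theorem stateMoment_self (hx : IsStationaryColoredNoiseProcess P A Q τ x η W)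
    (u v : PhaseSpace n →L[ℝ] ℝ) (t : ℝ≥0) :
    stateMoment P x η u v t t = stateMoment P x η u v 0 0 := by
  rw [hx.stateMoment_eq_of_le u v le_rfl, tsub_self]

/-- Paths of `x` are continuous because they are differentiable. Fubini's theorem gets its joint
measurability from this. -/
theorem ae_continuous (hx : IsStationaryColoredNoiseProcess P A Q τ x η W) :
    ∀ᵐ ω ∂P, ∀ u : PhaseSpace n →L[ℝ] ℝ,
      Continuous fun s : ℝ => u (x s.toNNReal ω, η s.toNNReal ω) := by
  filter_upwards [hx.continuous_noise, hx.state_eq] with ω hη hd u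
  have h1 : Continuous fun s : ℝ => x s.toNNReal ω := by
    have hon : ContinuousOn (fun s : ℝ => x s.toNNReal ω) (Set.Ici 0) := by
      intro s hs
      have := (hd s.toNNReal).continuousWithinAt
      rwa [Real.coe_toNNReal s hs] at this
    have := hon.comp_continuous (f := fun s : ℝ => max s 0) (by fun_prop)
      fun s => Set.mem_Ici.2 (le_max_right _ _)
    refine this.congr fun s => ?_
    simp only [Function.comp_apply]
    rcases le_total 0 s with h | h
    · rw [max_eq_left h]
    · rw [max_eq_right h, Real.toNNReal_of_nonpos h, Real.toNNReal_zero]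
  have h2 : Continuous fun s : ℝ => η s.toNNReal ω := hη.comp continuous_real_toNNReal
  exact u.continuous.comp (h1.prodMk h2)

theorem integrable_state_mul (hx : IsStationaryColoredNoiseProcess P A Q τ x η W)
    (u : PhaseSpace n →L[ℝ] ℝ) {Z : Ω → ℝ} (hZ : MemLp Z 2 P) (t : ℝ≥0) :
    Integrable (fun ω => u (x t ω, η t ω) * Z ω) P :=
  (hx.memLp_state u t).integrable_mul hZ

theorem noise_eq_apply (hx : IsStationaryColoredNoiseProcess P A Q τ x η W) (i : Fin n) :
    ∀ᵐ ω ∂P, ∀ t : ℝ, 0 ≤ t → noiseCoord i (x t.toNNReal ω, η t.toNNReal ω) =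
      noiseCoord i (x 0 ω, η 0 ω)
        - (1 / τ) * (∫ s in (0 : ℝ)..t, noiseCoord i (x s.toNNReal ω, η s.toNNReal ω))
        + (1 / τ) * W t.toNNReal ω i := by
  filter_upwards [hx.noise_eq, hx.continuous_noise] with ω h hc t ht
  have h1 := congrFun (h t.toNNReal) i
  have h2 := (ContinuousLinearMap.proj (R := ℝ) (φ := fun _ : Fin n => ℝ) i).intervalIntegral_comp_comm
    ((hc.comp continuous_real_toNNReal).intervalIntegrable (μ := volume) 0 t)
  simp only [Function.comp_apply, ContinuousLinearMap.proj_apply] at h2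
  simp only [Pi.add_apply, Pi.sub_apply, Pi.smul_apply, smul_eq_mul, Real.coe_toNNReal t ht,
    ← h2] at h1
  exact h1

theorem state_eq_apply (hx : IsStationaryColoredNoiseProcess P A Q τ x η W) (i : Fin n) :
    ∀ᵐ ω ∂P, ∀ t : ℝ, 0 ≤ t →
      HasDerivWithinAt (fun s : ℝ => posCoord i (x s.toNNReal ω, η s.toNNReal ω))
        (driftCoord A (CFC.sqrt ((2 : ℝ) • Q)) i (x t.toNNReal ω, η t.toNNReal ω))
        (Set.Ici 0) t := by
  filter_upwards [hx.state_eq] with ω h t ht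
  have h1 := h t.toNNReal
  rw [Real.coe_toNNReal t ht, hasDerivWithinAt_pi] at h1
  rw [driftCoord_apply]
  exact h1 i

theorem state_eq_integral (hx : IsStationaryColoredNoiseProcess P A Q τ x η W) (i : Fin n) :
    ∀ᵐ ω ∂P, ∀ t : ℝ, 0 ≤ t → posCoord i (x t.toNNReal ω, η t.toNNReal ω) =
      posCoord i (x 0 ω, η 0 ω) + ∫ s in (0 : ℝ)..t,
        driftCoord A (CFC.sqrt ((2 : ℝ) • Q)) i (x s.toNNReal ω, η s.toNNReal ω) := by
  filter_upwards [hx.state_eq_apply i, hx.ae_continuous] with ω h hc t ht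
  rw [intervalIntegral.integral_eq_sub_of_hasDeriv_right_of_le ht
    (f := fun s : ℝ => posCoord i (x s.toNNReal ω, η s.toNNReal ω))
    (hc _).continuousOn (fun s hs => (h s hs.1.le).mono fun r hr => (hs.1.trans hr).le)
    ((hc _).intervalIntegrable _ _), Real.toNNReal_zero]
  ring

theorem memLp_brownian (hx : IsStationaryColoredNoiseProcess P A Q τ x η W) (i : Fin n) (t : ℝ≥0) :
    MemLp (fun ω => W t ω i) 2 P :=
  ((hx.brownian.brownian i).hasLaw_eval t).hasGaussianLaw.memLp_two

theorem integral_brownian (hx : IsStationaryColoredNoiseProcess P A Q τ x η W) (i : Fin n)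
    (t : ℝ≥0) : ∫ ω, W t ω i ∂P = 0 :=
  (hx.brownian.brownian i).integral_eval t

/-- Independence factors the expectation, and `W` has mean zero. This is where causality enters. -/
theorem integral_brownian_mul_init (hx : IsStationaryColoredNoiseProcess P A Q τ x η W) (i : Fin n)
    (v : PhaseSpace n →L[ℝ] ℝ) (t : ℝ≥0) : ∫ ω, W t ω i * v (x 0 ω, η 0 ω) ∂P = 0 := by
  have h1 := hx.indep_init.symm.comp (φ := fun w : ℝ≥0 → Fin n → ℝ => w t i) (ψ := v)
    (Measurable.comp (g := fun y : Fin n → ℝ => y i) (measurable_pi_apply i)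
      (measurable_pi_apply t)) v.continuous.measurable
  have h2 := h1.integral_mul_eq_mul_integral (hx.memLp_brownian i t).aestronglyMeasurable
    (hx.memLp_state v 0).aestronglyMeasurable
  refine h2.trans ?_
  simp only [Function.comp_def, hx.integral_brownian, zero_mul]

/-! ### Averaged equations and equal-time moments -/

variable [IsProbabilityMeasure P]

/-- Second moments commute with time integrals. -/
theorem integral_integral_mul (hx : IsStationaryColoredNoiseProcess P A Q τ x η W)
    (u : PhaseSpace n →L[ℝ] ℝ) {Z : Ω → ℝ} (hZ : MemLp Z 2 P) (a b : ℝ) :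
    IntervalIntegrable (fun s : ℝ => ∫ ω, u (x s.toNNReal ω, η s.toNNReal ω) * Z ω ∂P)
      volume a b ∧
    Integrable (fun ω => (∫ s in a..b, u (x s.toNNReal ω, η s.toNNReal ω)) * Z ω) P ∧
    ∫ ω, (∫ s in a..b, u (x s.toNNReal ω, η s.toNNReal ω)) * Z ω ∂P =
      ∫ s in a..b, ∫ ω, u (x s.toNNReal ω, η s.toNNReal ω) * Z ω ∂P := by
  refine integral_intervalIntegral_mul_of_continuous
    (Y := fun s ω => u (x s.toNNReal ω, η s.toNNReal ω))
    (fun s => hx.measurable_state u _) (hx.ae_continuous.mono fun ω h => h u)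
    hZ.aestronglyMeasurable (fun s => hx.integrable_state_mul u hZ _)
    -- From `|a b| ≤ a² + b²`; stationarity makes the bound independent of time.
    (c := stateMoment P x η u u 0 0 + ∫ ω, Z ω * Z ω ∂P) (fun s => ?_) a b
  have hZZ : Integrable (fun ω => Z ω * Z ω) P := hZ.integrable_mul hZ
  rw [← hx.stateMoment_self u u s.toNNReal, stateMoment,
    ← integral_add (hx.integrable_mul u u _ _) hZZ]
  refine integral_mono (hx.integrable_state_mul u hZ _).norm
    ((hx.integrable_mul u u _ _).add hZZ) fun ω => ?_
  simp only [norm_mul, Real.norm_eq_abs]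
  nlinarith [sq_nonneg (|u (x s.toNNReal ω, η s.toNNReal ω)| - |Z ω|),
    abs_mul_abs_self (u (x s.toNNReal ω, η s.toNNReal ω)), abs_mul_abs_self (Z ω),
    mul_self_nonneg (u (x s.toNNReal ω, η s.toNNReal ω)), mul_self_nonneg (Z ω)]

theorem integral_brownian_mul (hx : IsStationaryColoredNoiseProcess P A Q τ x η W) (i j : Fin n)
    {s t : ℝ≥0} (h : s ≤ t) : ∫ ω, W s ω i * W t ω j ∂P = if i = j then (s : ℝ) else 0 := by
  split_ifs with hij
  · subst hij
    have := (hx.brownian.brownian i).covariance_eval s t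
    rw [covariance_eq_sub (hx.memLp_brownian i s) (hx.memLp_brownian i t), hx.integral_brownian,
      zero_mul, sub_zero, min_eq_left h] at this
    exact this
  · have h1 := (hx.brownian.indep.indepFun hij).comp (measurable_pi_apply s)
      (measurable_pi_apply t)
    have h2 := h1.integral_mul_eq_mul_integral (hx.memLp_brownian i s).aestronglyMeasurable
      (hx.memLp_brownian j t).aestronglyMeasurable
    refine h2.trans ?_
    simp only [Function.comp_def, hx.integral_brownian, zero_mul]

/-- The noise equation multiplied by a random variable and averaged. -/
theorem integral_noise_mul (hx : IsStationaryColoredNoiseProcess P A Q τ x η W) (i : Fin n)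
    {Z : Ω → ℝ} (hZ : MemLp Z 2 P) {t : ℝ} (ht : 0 ≤ t) :
    ∫ ω, noiseCoord i (x t.toNNReal ω, η t.toNNReal ω) * Z ω ∂P =
      ∫ ω, noiseCoord i (x 0 ω, η 0 ω) * Z ω ∂P
      - (1 / τ) * (∫ s in (0 : ℝ)..t,
          ∫ ω, noiseCoord i (x s.toNNReal ω, η s.toNNReal ω) * Z ω ∂P)
      + (1 / τ) * ∫ ω, W t.toNNReal ω i * Z ω ∂P := by
  obtain ⟨-, hI, hE⟩ := hx.integral_integral_mul (noiseCoord i) hZ 0 t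
  have h0 := hx.integrable_state_mul (noiseCoord i) hZ 0
  have hW : Integrable (fun ω => W t.toNNReal ω i * Z ω) P := (hx.memLp_brownian i t.toNNReal).integrable_mul hZ
  have h0I : Integrable (fun ω => noiseCoord i (x 0 ω, η 0 ω) * Z ω -
      1 / τ * ((∫ s in (0 : ℝ)..t, noiseCoord i (x s.toNNReal ω, η s.toNNReal ω)) * Z ω)) P :=
    h0.sub (hI.const_mul _)
  rw [← hE, ← integral_const_mul, ← integral_const_mul, ← integral_sub h0 (hI.const_mul _),
    ← integral_add h0I (hW.const_mul _)]
  refine integral_congr_ae ?_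
  filter_upwards [hx.noise_eq_apply i] with ω h
  rw [h t ht]
  ring

/-- The state equation multiplied by a random variable and averaged. -/
theorem integral_pos_mul (hx : IsStationaryColoredNoiseProcess P A Q τ x η W) (i : Fin n)
    {Z : Ω → ℝ} (hZ : MemLp Z 2 P) {t : ℝ} (ht : 0 ≤ t) :
    ∫ ω, posCoord i (x t.toNNReal ω, η t.toNNReal ω) * Z ω ∂P =
      ∫ ω, posCoord i (x 0 ω, η 0 ω) * Z ω ∂P
      + ∫ s in (0 : ℝ)..t, ∫ ω, driftCoord A (CFC.sqrt ((2 : ℝ) • Q)) i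
          (x s.toNNReal ω, η s.toNNReal ω) * Z ω ∂P := by
  obtain ⟨-, hI, hE⟩ := hx.integral_integral_mul (driftCoord A (CFC.sqrt ((2 : ℝ) • Q)) i) hZ 0 t
  rw [← hE, ← integral_add (hx.integrable_state_mul (posCoord i) hZ 0) hI]
  refine integral_congr_ae ?_
  filter_upwards [hx.state_eq_integral i] with ω h
  rw [h t ht]
  ring

/-- When `⟨W(s) Z⟩` is linear in `s`, the averaged noise equation closes into scalar relaxation. It
is used with `Z` an initial functional (`b = 0`) and with `Z` a component of `W(1)`. -/
theorem integral_noise_mul_of_brownian (hx : IsStationaryColoredNoiseProcess P A Q τ x η W)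
    (i : Fin n) {Z : Ω → ℝ} (hZ : MemLp Z 2 P) {T b : ℝ} (hT : 0 ≤ T)
    (hb : ∀ s ∈ Set.Icc 0 T, ∫ ω, W s.toNNReal ω i * Z ω ∂P = b * s) :
    ∫ ω, noiseCoord i (x T.toNNReal ω, η T.toNNReal ω) * Z ω ∂P =
      b + (∫ ω, noiseCoord i (x 0 ω, η 0 ω) * Z ω ∂P - b) * Real.exp (-T / τ) := by
  refine eq_of_relaxation_eq
    (g := fun s => ∫ ω, noiseCoord i (x s.toNNReal ω, η s.toNNReal ω) * Z ω ∂P) hT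
    (hx.integral_integral_mul (noiseCoord i) hZ 0 T).1 fun s hs => ?_
  rw [hx.integral_noise_mul i hZ hs.1, hb s hs]

theorem stateMoment_noise_zero (hx : IsStationaryColoredNoiseProcess P A Q τ x η W)
    (i : Fin n) (v : PhaseSpace n →L[ℝ] ℝ) {t : ℝ} (ht : 0 ≤ t) :
    stateMoment P x η (noiseCoord i) v t.toNNReal 0 =
      Real.exp (-t / τ) * stateMoment P x η (noiseCoord i) v 0 0 := by
  have := hx.integral_noise_mul_of_brownian i (hx.memLp_state v 0) ht (b := 0)
    fun s _ => by rw [hx.integral_brownian_mul_init, zero_mul]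
  rw [stateMoment, this, zero_add, sub_zero, mul_comm]
  rfl

theorem toNNReal_sub_toNNReal {s t : ℝ} (hs : 0 ≤ s) :
    t.toNNReal - s.toNNReal = (t - s).toNNReal := by
  rw [NNReal.sub_def, Real.coe_toNNReal s hs]
  rcases le_total 0 t with ht | ht
  · rw [Real.coe_toNNReal t ht]
  · rw [Real.toNNReal_of_nonpos ht, Real.toNNReal_of_nonpos (by linarith : t - s ≤ 0),
      NNReal.coe_zero, Real.toNNReal_of_nonpos (by linarith)]

/-- Shifting the earlier time to `0` reduces this to the decay of noise against the initial state;
the order `s ≤ t` is essential. -/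
theorem stateMoment_noise_right (hx : IsStationaryColoredNoiseProcess P A Q τ x η W)
    (u : PhaseSpace n →L[ℝ] ℝ) (j : Fin n) {s t : ℝ} (hs : 0 ≤ s) (hst : s ≤ t) :
    stateMoment P x η u (noiseCoord j) s.toNNReal t.toNNReal =
      Real.exp ((s - t) / τ) * stateMoment P x η u (noiseCoord j) 0 0 := by
  rw [hx.stateMoment_eq_of_le _ _ (Real.toNNReal_mono hst), stateMoment_comm,
    toNNReal_sub_toNNReal hs,
    hx.stateMoment_noise_zero _ _ (sub_nonneg.2 hst), stateMoment_comm P x η u, neg_sub]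

theorem integral_exp_sub_div (hτ : 0 < τ) (t : ℝ) :
    ∫ s in (0 : ℝ)..t, Real.exp ((s - t) / τ) = τ * (1 - Real.exp (-t / τ)) := by
  have hd : ∀ s ∈ Set.uIcc 0 t, HasDerivAt (fun s => τ * Real.exp ((s - t) / τ))
      (Real.exp ((s - t) / τ)) s := by
    intro s _
    have := ((((hasDerivAt_id s).sub_const t).div_const τ).exp).const_mul τ
    rw [mul_one_div, mul_div_cancel₀ _ hτ.ne'] at this
    exact this
  rw [intervalIntegral.integral_eq_sub_of_hasDerivAt hd
    (Continuous.intervalIntegrable (by fun_prop) _ _)]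
  simp
  ring

theorem integral_stateMoment_noise_right (hx : IsStationaryColoredNoiseProcess P A Q τ x η W)
    (hτ : 0 < τ) (u : PhaseSpace n →L[ℝ] ℝ) (j : Fin n) {t : ℝ} (ht : 0 ≤ t) :
    ∫ s in (0 : ℝ)..t, stateMoment P x η u (noiseCoord j) s.toNNReal t.toNNReal =
      τ * (1 - Real.exp (-t / τ)) * stateMoment P x η u (noiseCoord j) 0 0 := by
  rw [← integral_exp_sub_div hτ, ← intervalIntegral.integral_mul_const]
  refine intervalIntegral.integral_congr fun s hs => ?_
  rw [Set.uIcc_of_le ht] at hs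
  exact hx.stateMoment_noise_right u j hs.1 hs.2

theorem exp_neg_one_div_lt_one (hτ : 0 < τ) : Real.exp (-1 / τ) < 1 := by
  rw [Real.exp_lt_one_iff]
  exact div_neg_of_neg_of_pos (by norm_num) hτ

/-- The stationary covariance of the noise is `I / (2 τ)`. -/
theorem stateMoment_noise_noise (hx : IsStationaryColoredNoiseProcess P A Q τ x η W) (hτ : 0 < τ)
    (i j : Fin n) : stateMoment P x η (noiseCoord i) (noiseCoord j) 0 0 =
      if i = j then 1 / (2 * τ) else 0 := by
  -- The noise equation on `[0, 1]` is tested against `η_j(1)`, so that all states precede the test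
  -- noise. The remaining term `⟨W_i(1) η_j(1)⟩` is found by relaxing `η_j` against `W_i(1)`; a
  -- factor `1 - exp (-1 / τ)` then cancels.
  have h1 := hx.integral_noise_mul i (hx.memLp_state (noiseCoord j) (1 : ℝ).toNNReal) zero_le_one
  have h2 := hx.integral_noise_mul_of_brownian j (hx.memLp_brownian i (1 : ℝ).toNNReal) zero_le_one
    (b := if i = j then 1 else 0) fun s hs => by
      rw [hx.integral_brownian_mul j i (Real.toNNReal_mono hs.2), Real.coe_toNNReal s hs.1]
      simp [eq_comm]
  simp only [mul_comm (noiseCoord j _)] at h2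
  rw [hx.integral_brownian_mul_init] at h2
  rw [h2] at h1
  have h3 := hx.integral_stateMoment_noise_right hτ (noiseCoord i) j zero_le_one
  simp only [stateMoment] at h3
  rw [h3] at h1
  have h4 := hx.stateMoment_noise_right (noiseCoord i) j le_rfl zero_le_one
  have h5 := hx.stateMoment_self (noiseCoord i) (noiseCoord j) (1 : ℝ).toNNReal
  rw [Real.toNNReal_zero] at h4
  simp only [stateMoment] at h4 h5 ⊢
  rw [h4, h5, zero_sub] at h1
  have he := exp_neg_one_div_lt_one hτ
  set N := ∫ ω, noiseCoord i (x 0 ω, η 0 ω) * noiseCoord j (x 0 ω, η 0 ω) ∂P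
  set e := Real.exp (-1 / τ)
  have h6 : (1 - e) * (2 * τ * N - if i = j then 1 else 0) = 0 := by
    field_simp at h1
    linarith
  have h7 := (mul_eq_zero.1 h6).resolve_left (by linarith)
  split_ifs at h7 ⊢
  · field_simp
    linarith
  · have : 2 * τ ≠ 0 := by positivity
    exact (mul_eq_zero.1 (by linarith : 2 * τ * N = 0)).resolve_left this

/-- Integrated form of `0 = d/dt ⟨x ηᵀ⟩ = ⟨(dx/dt) ηᵀ⟩ - ⟨x ηᵀ⟩ / τ`, again obtained by testing
against `η(1)`. -/
theorem stateMoment_pos_noise (hx : IsStationaryColoredNoiseProcess P A Q τ x η W) (hτ : 0 < τ)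
    (i j : Fin n) : stateMoment P x η (posCoord i) (noiseCoord j) 0 0 =
      τ * stateMoment P x η (driftCoord A (CFC.sqrt ((2 : ℝ) • Q)) i) (noiseCoord j) 0 0 := by
  have h1 := hx.integral_pos_mul i (hx.memLp_state (noiseCoord j) (1 : ℝ).toNNReal) zero_le_one
  have h3 := hx.integral_stateMoment_noise_right hτ (driftCoord A (CFC.sqrt ((2 : ℝ) • Q)) i) j
    zero_le_one
  have h4 := hx.stateMoment_noise_right (posCoord i) j le_rfl zero_le_one
  have h5 := hx.stateMoment_self (posCoord i) (noiseCoord j) (1 : ℝ).toNNReal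
  rw [Real.toNNReal_zero] at h4
  simp only [stateMoment] at h3 h4 h5 ⊢
  rw [h3, h4, h5, zero_sub] at h1
  have he := exp_neg_one_div_lt_one hτ
  refine mul_left_cancel₀ (sub_pos.2 he).ne' ?_
  linarith

/-- Since `x` has differentiable paths, the ordinary product rule holds for `x_i x_j`. Integrating
it over `[0, 1]` and averaging gives zero by stationarity. -/
theorem stateMoment_drift_pos_add (hx : IsStationaryColoredNoiseProcess P A Q τ x η W)
    (i j : Fin n) :
    stateMoment P x η (driftCoord A (CFC.sqrt ((2 : ℝ) • Q)) i) (posCoord j) 0 0 +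
      stateMoment P x η (posCoord i) (driftCoord A (CFC.sqrt ((2 : ℝ) • Q)) j) 0 0 = 0 := by
  set G := driftCoord A (CFC.sqrt ((2 : ℝ) • Q))
  have hI : ∀ (u v u' v' : PhaseSpace n →L[ℝ] ℝ) (s : ℝ≥0), Integrable (fun ω =>
      u (x s ω, η s ω) * v (x s ω, η s ω) + u' (x s ω, η s ω) * v' (x s ω, η s ω)) P :=
    fun u v u' v' s => (hx.integrable_mul u v s s).add (hx.integrable_mul u' v' s s)
  have hab : ∀ s, ∫ ω, ‖(G i (x s ω, η s ω) * posCoord j (x s ω, η s ω)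
      + posCoord i (x s ω, η s ω) * G j (x s ω, η s ω)) * 1‖ ∂P ≤
      stateMoment P x η (G i) (G i) 0 0 + stateMoment P x η (posCoord j) (posCoord j) 0 0 +
      (stateMoment P x η (posCoord i) (posCoord i) 0 0 + stateMoment P x η (G j) (G j) 0 0) := by
    intro s
    rw [← hx.stateMoment_self (G i) (G i) s, ← hx.stateMoment_self (posCoord j) (posCoord j) s,
      ← hx.stateMoment_self (posCoord i) (posCoord i) s, ← hx.stateMoment_self (G j) (G j) s]
    simp only [stateMoment]
    rw [← integral_add (hx.integrable_mul _ _ _ _) (hx.integrable_mul _ _ _ _),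
      ← integral_add (hx.integrable_mul _ _ _ _) (hx.integrable_mul _ _ _ _),
      ← integral_add (hI _ _ _ _ _) (hI _ _ _ _ _)]
    refine integral_mono ((hI _ _ _ _ _).mul_const 1).norm
      ((hI _ _ _ _ _).add (hI _ _ _ _ _)) fun ω => ?_
    simp only [mul_one, Real.norm_eq_abs]
    generalize G i (x s ω, η s ω) = a
    generalize posCoord j (x s ω, η s ω) = b
    generalize posCoord i (x s ω, η s ω) = c
    generalize G j (x s ω, η s ω) = d
    rw [abs_le]
    constructor <;> nlinarith [sq_nonneg (a + b), sq_nonneg (c + d), sq_nonneg (a - b),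
      sq_nonneg (c - d), sq_nonneg a, sq_nonneg b, sq_nonneg c, sq_nonneg d]
  obtain ⟨-, -, h⟩ := integral_intervalIntegral_mul_of_continuous (P := P)
    (Y := fun s ω => G i (x s.toNNReal ω, η s.toNNReal ω) * posCoord j (x s.toNNReal ω, η s.toNNReal ω)
      + posCoord i (x s.toNNReal ω, η s.toNNReal ω) * G j (x s.toNNReal ω, η s.toNNReal ω))
    (Z := fun _ => 1)
    (fun s => ((hx.measurable_state _ _).mul (hx.measurable_state _ _)).add
      ((hx.measurable_state _ _).mul (hx.measurable_state _ _)))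
    (hx.ae_continuous.mono fun ω h => ((h _).mul (h _)).add ((h _).mul (h _)))
    aestronglyMeasurable_const
    (fun s => (hI _ _ _ _ _).mul_const 1)
    (fun s => hab _) 0 1
  have hl : ∀ᵐ ω ∂P, (∫ s in (0 : ℝ)..1, G i (x s.toNNReal ω, η s.toNNReal ω)
        * posCoord j (x s.toNNReal ω, η s.toNNReal ω)
      + posCoord i (x s.toNNReal ω, η s.toNNReal ω) * G j (x s.toNNReal ω, η s.toNNReal ω)) * 1 =
      posCoord i (x (1 : ℝ).toNNReal ω, η (1 : ℝ).toNNReal ω)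
        * posCoord j (x (1 : ℝ).toNNReal ω, η (1 : ℝ).toNNReal ω)
      - posCoord i (x 0 ω, η 0 ω) * posCoord j (x 0 ω, η 0 ω) := by
    filter_upwards [hx.state_eq_apply i, hx.state_eq_apply j, hx.ae_continuous] with ω hi hj hc
    rw [mul_one, intervalIntegral.integral_eq_sub_of_hasDeriv_right_of_le zero_le_one
      (f := fun s : ℝ => posCoord i (x s.toNNReal ω, η s.toNNReal ω)
        * posCoord j (x s.toNNReal ω, η s.toNNReal ω))
      ((hc _).mul (hc _)).continuousOn
      (fun s hs => ((hi s hs.1.le).mul (hj s hs.1.le)).mono fun r hr => (hs.1.trans hr).le)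
      ((((hc _).mul (hc _)).add ((hc _).mul (hc _))).intervalIntegrable _ _), Real.toNNReal_zero]
  rw [integral_congr_ae hl, integral_sub (hx.integrable_mul _ _ _ _) (hx.integrable_mul _ _ _ _)]
    at h
  have e1 := hx.stateMoment_self (posCoord i) (posCoord j) (1 : ℝ).toNNReal
  have e2 : ∀ s : ℝ, ∫ ω, (G i (x s.toNNReal ω, η s.toNNReal ω)
        * posCoord j (x s.toNNReal ω, η s.toNNReal ω)
      + posCoord i (x s.toNNReal ω, η s.toNNReal ω) * G j (x s.toNNReal ω, η s.toNNReal ω)) * 1 ∂P =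
      stateMoment P x η (G i) (posCoord j) 0 0 + stateMoment P x η (posCoord i) (G j) 0 0 := by
    intro s
    rw [← hx.stateMoment_self (G i) (posCoord j) s.toNNReal,
      ← hx.stateMoment_self (posCoord i) (G j) s.toNNReal]
    simp only [stateMoment, mul_one]
    exact integral_add (hx.integrable_mul _ _ _ _) (hx.integrable_mul _ _ _ _)
  simp only [e2] at h
  simp only [stateMoment] at e1
  rw [e1, sub_self, intervalIntegral.integral_const, sub_zero, one_smul] at h
  exact h.symm

theorem stateMoment_pos_zero_eq_integral (hx : IsStationaryColoredNoiseProcess P A Q τ x η W)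
    (i : Fin n) (v : PhaseSpace n →L[ℝ] ℝ) {t : ℝ} (ht : 0 ≤ t) :
    stateMoment P x η (posCoord i) v t.toNNReal 0 =
      stateMoment P x η (posCoord i) v 0 0 + ∫ s in (0 : ℝ)..t,
        stateMoment P x η (driftCoord A (CFC.sqrt ((2 : ℝ) • Q)) i) v s.toNNReal 0 :=
  hx.integral_pos_mul i (hx.memLp_state v 0) ht

theorem hasDerivWithinAt_stateMoment_pos (hx : IsStationaryColoredNoiseProcess P A Q τ x η W)
    (i : Fin n) (v : PhaseSpace n →L[ℝ] ℝ) {t : ℝ} (ht : 0 ≤ t) :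
    HasDerivWithinAt (fun s : ℝ => stateMoment P x η (posCoord i) v s.toNNReal 0)
      (stateMoment P x η (driftCoord A (CFC.sqrt ((2 : ℝ) • Q)) i) v t.toNNReal 0)
      (Set.Ici 0) t := by
  -- Position moments are continuous as primitives and noise moments as exponentials; hence the
  -- drift moment is continuous and the integral equation can be differentiated.
  have hpos : ∀ l, ContinuousOn (fun s : ℝ => stateMoment P x η (posCoord l) v s.toNNReal 0)
      (Set.Ici 0) := by
    intro l s hs
    have h1 : ContinuousOn (fun s : ℝ => stateMoment P x η (posCoord l) v s.toNNReal 0)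
        (Set.Icc 0 (s + 1)) :=
      continuousOn_of_eq_add_integral (by linarith [Set.mem_Ici.1 hs])
        (hx.integral_integral_mul _ (hx.memLp_state v 0) 0 (s + 1)).1
        fun r hr => hx.stateMoment_pos_zero_eq_integral l v hr.1
    refine (h1 s ⟨hs, by linarith⟩).mono_of_mem_nhdsWithin ?_
    rw [← Set.Ici_inter_Iic]
    exact Filter.inter_mem self_mem_nhdsWithin (mem_nhdsWithin_of_mem_nhds
      (Iic_mem_nhds (by linarith)))
  have hnoise : ∀ l, ContinuousOn (fun s : ℝ => stateMoment P x η (noiseCoord l) v s.toNNReal 0)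
      (Set.Ici 0) := by
    intro l
    refine ContinuousOn.congr (f := fun s : ℝ =>
      Real.exp (-s / τ) * stateMoment P x η (noiseCoord l) v 0 0) (by fun_prop) fun s hs => ?_
    exact hx.stateMoment_noise_zero l v hs
  refine hasDerivWithinAt_of_eq_add_integral (a := stateMoment P x η (posCoord i) v 0 0) ?_
    (fun s hs => hx.stateMoment_pos_zero_eq_integral i v hs) ht
  simp only [hx.stateMoment_drift_left]
  exact (continuousOn_finsetSum _ fun l _ => continuousOn_const.mul (hpos l)).add
    (continuousOn_finsetSum _ fun l _ => continuousOn_const.mul (hnoise l))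

end IsStationaryColoredNoiseProcess

/-! ### Matrix algebra of the three relations -/

section Relations

variable {n : ℕ} {A Q C : Matrix (Fin n) (Fin n) ℝ} {τ : ℝ}

theorem noiseResolvent_mul_eq (hu : IsUnit (1 - τ • A)) :
    noiseResolvent τ A * Q = Q + τ • (A * (noiseResolvent τ A * Q)) := by
  have h : (1 - τ • A) * (noiseResolvent τ A * Q) = Q := by
    rw [noiseResolvent, ← mul_assoc, Matrix.mul_nonsing_inv _ ((Matrix.isUnit_iff_isUnit_det _).1 hu),
      one_mul]
  rw [sub_mul, one_mul, smul_mul_assoc] at h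
  exact sub_eq_iff_eq_add.1 h

theorem mul_noiseResolvent_transpose_eq (hQ : Qᵀ = Q) (hu : IsUnit (1 - τ • A)) :
    Q * (noiseResolvent τ A)ᵀ = Q + τ • (Q * (noiseResolvent τ A)ᵀ * Aᵀ) := by
  have := congrArg Matrix.transpose (noiseResolvent_mul_eq (Q := Q) hu)
  simpa only [Matrix.transpose_add, Matrix.transpose_smul, Matrix.transpose_mul, hQ] using this

/-- The covariance of the velocity `A x + √(2Q) η`. -/
noncomputable def velocityCov (τ : ℝ) (A Q C : Matrix (Fin n) (Fin n) ℝ) : Matrix (Fin n) (Fin n) ℝ :=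
  A * C * Aᵀ + A * (noiseResolvent τ A * Q) + Q * (noiseResolvent τ A)ᵀ * Aᵀ + (1 / τ) • Q

theorem FluctuationDissipation.firstDeriv_eq (h : FluctuationDissipation τ A Q C) :
    A * C + Q * (noiseResolvent τ A)ᵀ = -(C * Aᵀ + noiseResolvent τ A * Q) := by
  rw [eq_neg_iff_add_eq_zero]
  refine Eq.trans ?_ h.symm
  abel

theorem FluctuationDissipation.firstDeriv_transpose (h : FluctuationDissipation τ A Q C)
    (hC : Cᵀ = C) (hQ : Qᵀ = Q) :
    (A * C + Q * (noiseResolvent τ A)ᵀ)ᵀ = -(A * C + Q * (noiseResolvent τ A)ᵀ) := by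
  rw [h.firstDeriv_eq, neg_neg, ← h.firstDeriv_eq]
  simp only [Matrix.transpose_add, Matrix.transpose_mul, Matrix.transpose_transpose, hC, hQ]

/-- This exhibits the second derivative at `0` as minus a covariance, giving both its symmetry and
its sign. -/
theorem FluctuationDissipation.secondDeriv_eq (h : FluctuationDissipation τ A Q C) (hτ : 0 < τ)
    (hQ : Qᵀ = Q) (hu : IsUnit (1 - τ • A)) :
    A * (A * C + Q * (noiseResolvent τ A)ᵀ) - (1 / τ) • (Q * (noiseResolvent τ A)ᵀ) =
      -velocityCov τ A Q C := by
  rw [h.firstDeriv_eq, mul_noiseResolvent_transpose_eq hQ hu, velocityCov, smul_add, smul_smul,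
    one_div_mul_cancel hτ.ne', one_smul, mul_neg, mul_add, mul_assoc, mul_assoc]
  abel

/-- The three relations satisfied by the derivatives of the correlation function. -/
theorem FluctuationDissipation.relations (h : FluctuationDissipation τ A Q C) (hτ : 0 < τ)
    (hC : Cᵀ = C) (hQ : Qᵀ = Q) (hu : IsUnit (1 - τ • A)) (hV : (velocityCov τ A Q C)ᵀ =
      velocityCov τ A Q C) {K₁ K₂ K₃ : Matrix (Fin n) (Fin n) ℝ}
    (h₁ : K₁ = A * C + Q * (noiseResolvent τ A)ᵀ)
    (h₂ : K₂ = A * K₁ - (1 / τ) • (Q * (noiseResolvent τ A)ᵀ))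
    (h₃ : K₃ = A * K₂ + (1 / τ ^ 2) • (Q * (noiseResolvent τ A)ᵀ)) :
    SecondDerivRelation τ A C K₁ K₂ ∧
      ThirdDerivRelation τ A C K₁ K₂ ((1 / 2 : ℝ) • (K₃ + -K₃ᵀ)) := by
  have hk : K₁ᵀ = -K₁ := by rw [h₁]; exact h.firstDeriv_transpose hC hQ
  have hs : K₂ᵀ = K₂ := by
    rw [h₂, h₁, h.secondDeriv_eq hτ hQ hu, Matrix.transpose_neg, hV]
  -- Eliminating `Q Bᵀ` leaves formulas in `A` and the data alone; symmetrizing the one for `K₂` and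
  -- antisymmetrizing the one for `K₃` gives the relations.
  have hN : Q * (noiseResolvent τ A)ᵀ = K₁ - A * C := by rw [h₁]; abel
  rw [hN] at h₂ h₃
  constructor
  · have h4 : K₂ = (1 / 2 : ℝ) • (K₂ + K₂ᵀ) := by rw [hs]; module
    rw [SecondDerivRelation, h4, h₂]
    simp only [Matrix.transpose_sub, Matrix.transpose_smul, Matrix.transpose_mul, hk, hC, mul_add,
      add_mul, mul_smul_comm, smul_mul_assoc]
    module
  · rw [ThirdDerivRelation, h₃]
    simp only [Matrix.transpose_add, Matrix.transpose_sub, Matrix.transpose_smul,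
      Matrix.transpose_mul, hk, hC, hs, mul_sub, sub_mul, mul_smul_comm, smul_mul_assoc]
    module

/-- The antisymmetric `K₁` cancels, leaving `(2 / τ) C`. -/
theorem posDef_add_transpose_of_antisymm (hC : C.PosDef) (hτ : 0 < τ)
    {K₁ : Matrix (Fin n) (Fin n) ℝ} (hk : K₁ᵀ = -K₁) :
    ((K₁ + (1 / τ) • C) + (K₁ + (1 / τ) • C)ᵀ).PosDef := by
  have hCs : Cᵀ = C := by
    simpa [Matrix.IsHermitian, Matrix.conjTranspose_eq_transpose_of_trivial] using hC.isHermitian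
  have : (K₁ + (1 / τ) • C) + (K₁ + (1 / τ) • C)ᵀ = (2 / τ) • C := by
    rw [Matrix.transpose_add, Matrix.transpose_smul, hk, hCs]
    module
  rw [this]
  exact hC.smul (by positivity)

theorem SecondDerivRelation.sub_mul_add {A' K₁ K₂ : Matrix (Fin n) (Fin n) ℝ} (hC : Cᵀ = C)
    (h : SecondDerivRelation τ A C K₁ K₂) (h' : SecondDerivRelation τ A' C K₁ K₂) :
    (A' - A) * (K₁ + (1 / τ) • C) + (K₁ + (1 / τ) • C)ᵀ * (A' - A)ᵀ = 0 := by
  have e := sub_eq_zero.2 (h'.symm.trans h)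
  rw [← smul_zero (2 : ℝ), ← e, Matrix.transpose_add, Matrix.transpose_smul, hC, Matrix.transpose_sub, sub_mul, mul_sub]
  module

theorem ThirdDerivRelation.sub_mul_eq {A' K₁ K₂ K₃ : Matrix (Fin n) (Fin n) ℝ}
    (h : ThirdDerivRelation τ A C K₁ K₂ K₃) (h' : ThirdDerivRelation τ A' C K₁ K₂ K₃) :
    (A' - A) * ((1 / τ ^ 2) • C - K₂) = ((1 / τ ^ 2) • C - K₂) * (A' - A)ᵀ := by
  have e := sub_eq_zero.2 (h'.symm.trans h)
  rw [← sub_eq_zero, ← neg_eq_zero, ← smul_zero (2 : ℝ), ← e, Matrix.transpose_sub]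
  simp only [sub_mul, mul_sub]
  module

/-- Subtracting the relations and multiplying by `E = 1 - τ A` on the left and `Eᵀ` on the right
removes both inverses and leaves a Lyapunov equation for `Q' - Q`. -/
theorem FluctuationDissipation.eq_of_isHurwitz {Q' : Matrix (Fin n) (Fin n) ℝ}
    (h : FluctuationDissipation τ A Q C) (h' : FluctuationDissipation τ A Q' C) (hA : IsHurwitz A)
    (hτ : 0 < τ) : Q' = Q := by
  have hu := (Matrix.isUnit_iff_isUnit_det _).1 (hA.isUnit_one_sub_smul hτ)
  set E := 1 - τ • A with hE
  have h1 : E * E⁻¹ = 1 := Matrix.mul_nonsing_inv _ hu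
  have h2 : (E⁻¹)ᵀ * Eᵀ = 1 := by rw [← Matrix.transpose_mul, h1, Matrix.transpose_one]
  have e : (Q' - Q) * (E⁻¹)ᵀ + E⁻¹ * (Q' - Q) = 0 := by
    have := h.symm.trans h'
    simp only [noiseResolvent, ← hE] at this
    rw [sub_mul, mul_sub, ← sub_eq_zero.2 this.symm]
    abel
  refine sub_eq_zero.1 (hA.eq_zero_of_lyapunov hτ ?_)
  rw [← hE]
  calc E * (Q' - Q) + (Q' - Q) * Eᵀ
      = E * ((Q' - Q) * ((E⁻¹)ᵀ * Eᵀ)) + (E * E⁻¹) * ((Q' - Q) * Eᵀ) := by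
        rw [h1, h2, mul_one, one_mul]
    _ = E * ((Q' - Q) * (E⁻¹)ᵀ + E⁻¹ * (Q' - Q)) * Eᵀ := by
        simp only [mul_add, add_mul, mul_assoc]
    _ = 0 := by rw [e]; simp

end Relations

/-! ### Extension from the half-line to negative times -/

section Reflection

variable {n : ℕ}

/-- Extension of a matrix function on `[0, ∞)` to the line with `F (-s) = ε F(s)ᵀ`. -/
noncomputable def reflectExt (ε : ℝ) (F : ℝ → Matrix (Fin n) (Fin n) ℝ) (s : ℝ) : Matrix (Fin n) (Fin n) ℝ :=
  if 0 ≤ s then F s else ε • (F (-s))ᵀ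

theorem reflectExt_zero (ε : ℝ) (F : ℝ → Matrix (Fin n) (Fin n) ℝ) : reflectExt ε F 0 = F 0 :=
  if_pos le_rfl

theorem reflectExt_apply (ε : ℝ) (F : ℝ → Matrix (Fin n) (Fin n) ℝ) (s : ℝ) (i j : Fin n) :
    reflectExt ε F s i j = if 0 ≤ s then F s i j else ε * F (-s) j i := by
  rw [reflectExt]
  split_ifs <;> rfl

/-- Differentiation reverses the parity `ε`; the two conditions at `0` make values and one-sided
derivatives match. -/
theorem hasMatrixDerivWithinAt_reflectExt {ε : ℝ} {F F' : ℝ → Matrix (Fin n) (Fin n) ℝ}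
    (h : ∀ s, 0 ≤ s → HasMatrixDerivWithinAt F (F' s) (Set.Ici 0) s)
    (h0 : F 0 = ε • (F 0)ᵀ) (h0' : F' 0 = (-ε) • (F' 0)ᵀ) (s : ℝ) :
    HasMatrixDerivWithinAt (reflectExt ε F) (reflectExt (-ε) F' s) Set.univ s := by
  intro i j
  rw [hasDerivWithinAt_univ]
  simp only [reflectExt_apply]
  exact hasDerivAt_reflect (h := fun s => F s i j) (g := fun s => F s j i)
    (h' := fun s => F' s i j) (g' := fun s => F' s j i) (fun s hs => h s hs i j)
    (fun s hs => h s hs j i) (congrFun (congrFun h0 i) j) (congrFun (congrFun h0' i) j) s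

theorem hasMatrixDerivWithinAt_reflectExt_Ici (ε : ℝ) {F : ℝ → Matrix (Fin n) (Fin n) ℝ}
    {D : Matrix (Fin n) (Fin n) ℝ} (h : HasMatrixDerivWithinAt F D (Set.Ici 0) 0) :
    HasMatrixDerivWithinAt (reflectExt ε F) D (Set.Ici 0) 0 := fun i j =>
  (h i j).congr (fun s hs => by rw [reflectExt_apply, if_pos (Set.mem_Ici.1 hs)]) (by rw [reflectExt_zero])

theorem hasMatrixDerivWithinAt_reflectExt_Iic {F : ℝ → Matrix (Fin n) (Fin n) ℝ}
    {D : Matrix (Fin n) (Fin n) ℝ} (h : HasMatrixDerivWithinAt F D (Set.Ici 0) 0)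
    (h0 : (F 0)ᵀ = F 0) :
    HasMatrixDerivWithinAt (reflectExt 1 F) (-Dᵀ) (Set.Iic 0) 0 := by
  intro i j
  have h1 : HasDerivWithinAt (fun u => F u j i) (D j i) (Set.Ici 0) (-0) := by
    rw [neg_zero]
    exact h j i
  have e : F 0 i j = F 0 j i := congrFun (congrFun h0 j) i
  refine h1.comp_neg_Iic.congr (fun s hs => ?_) (by rw [reflectExt_zero, neg_zero, e])
  rw [reflectExt_apply]
  split_ifs with hs'
  · rw [le_antisymm hs hs', neg_zero, e]
  · rw [one_mul]

/-- Every half-line derivative of `K` has the form `A F + f N`, so this rule can be iterated. -/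
theorem HasMatrixDerivWithinAt.mul_add_smul {F : ℝ → Matrix (Fin n) (Fin n) ℝ}
    {D : Matrix (Fin n) (Fin n) ℝ} {S : Set ℝ} {s : ℝ} (h : HasMatrixDerivWithinAt F D S s)
    (A N : Matrix (Fin n) (Fin n) ℝ) {f : ℝ → ℝ} {f' : ℝ} (hf : HasDerivWithinAt f f' S s) :
    HasMatrixDerivWithinAt (fun u => A * F u + f u • N) (A * D + f' • N) S s := by
  intro i j
  simp only [Matrix.add_apply, Matrix.mul_apply, Matrix.smul_apply, smul_eq_mul]
  exact (HasDerivWithinAt.fun_sum fun l _ => (h l j).const_mul _).add (hf.mul_const _)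

end Reflection

theorem Matrix.PosDef.transpose_eq {n : ℕ} {M : Matrix (Fin n) (Fin n) ℝ} (hM : M.PosDef) :
    Mᵀ = M := by
  have := hM.isHermitian
  rwa [Matrix.IsHermitian, Matrix.conjTranspose_eq_transpose_of_trivial] at this

theorem correlation_eq_reflectExt {Ω : Type*} [MeasurableSpace Ω] (P : Measure Ω) {n : ℕ}
    (x : ℝ≥0 → Ω → Fin n → ℝ) :
    correlation P x = reflectExt 1 fun s => twoTimeMoment P x s.toNNReal 0 := by
  funext s
  rw [correlation, reflectExt]
  split_ifs with hs
  · rw [Real.toNNReal_of_nonpos (neg_nonpos.2 hs)]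
  · rw [Real.toNNReal_of_nonpos (not_le.1 hs).le, one_smul]
    ext i j
    simp only [twoTimeMoment, Matrix.of_apply, Matrix.transpose_apply, mul_comm]

/-! ### Moment matrices of the process -/

namespace IsStationaryColoredNoiseProcess

variable {Ω : Type*} [MeasurableSpace Ω] {P : Measure Ω} {n : ℕ}
  {A Q : Matrix (Fin n) (Fin n) ℝ} {τ : ℝ} {x η W : ℝ≥0 → Ω → Fin n → ℝ}

theorem twoTimeMoment_self (hx : IsStationaryColoredNoiseProcess P A Q τ x η W) (t : ℝ≥0) :
    twoTimeMoment P x t t = stationaryCov P x := by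
  ext i j
  exact hx.stateMoment_self (posCoord i) (posCoord j) t

theorem twoTimeMoment_eq_correlation (hx : IsStationaryColoredNoiseProcess P A Q τ x η W)
    (s t : ℝ≥0) : twoTimeMoment P x s t = correlation P x ((s : ℝ) - t) := by
  have h1 : ((s : ℝ) - t).toNNReal = s - t := NNReal.sub_def.symm
  have h2 : (-((s : ℝ) - t)).toNNReal = t - s := by rw [neg_sub, NNReal.sub_def]
  ext i j
  rw [correlation, h1, h2]
  change stateMoment P x η (posCoord i) (posCoord j) s t =
    stateMoment P x η (posCoord i) (posCoord j) (s - t) (t - s)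
  rcases le_total s t with h | h
  · rw [hx.stateMoment_eq_of_le _ _ h, tsub_eq_zero_of_le h]
  · rw [stateMoment_comm, hx.stateMoment_eq_of_le _ _ h, tsub_eq_zero_of_le h, stateMoment_comm]

/-- The stationary cross moment `⟨x ηᵀ⟩`. -/
noncomputable def crossMoment (P : Measure Ω) (x η : ℝ≥0 → Ω → Fin n → ℝ) :
    Matrix (Fin n) (Fin n) ℝ :=
  Matrix.of fun i j => stateMoment P x η (posCoord i) (noiseCoord j) 0 0

theorem sqrt_mul_sqrt (hQ : Q.PosDef) :
    CFC.sqrt ((2 : ℝ) • Q) * CFC.sqrt ((2 : ℝ) • Q) = (2 : ℝ) • Q :=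
  CFC.sqrt_mul_sqrt_self _ (hQ.smul two_pos).posSemidef.nonneg

theorem sqrt_transpose (Q : Matrix (Fin n) (Fin n) ℝ) :
    (CFC.sqrt ((2 : ℝ) • Q))ᵀ = CFC.sqrt ((2 : ℝ) • Q) := by
  have := (Matrix.nonneg_iff_posSemidef.1 (CFC.sqrt_nonneg ((2 : ℝ) • Q))).isHermitian
  rwa [Matrix.IsHermitian, Matrix.conjTranspose_eq_transpose_of_trivial] at this

theorem stationaryCov_transpose (P : Measure Ω) (x : ℝ≥0 → Ω → Fin n → ℝ) :
    (stationaryCov P x)ᵀ = stationaryCov P x := by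
  ext i j
  simp only [stationaryCov, twoTimeMoment, Matrix.of_apply, Matrix.transpose_apply, mul_comm]

theorem dotProduct_stateMoment_mulVec (hx : IsStationaryColoredNoiseProcess P A Q τ x η W)
    (u : Fin n → PhaseSpace n →L[ℝ] ℝ) (c : Fin n → ℝ) :
    c ⬝ᵥ (Matrix.of fun i j => stateMoment P x η (u i) (u j) 0 0) *ᵥ c =
      stateMoment P x η (∑ l, c l • u l) (∑ l, c l • u l) 0 0 := by
  rw [hx.stateMoment_sum_left]
  simp only [dotProduct, Matrix.mulVec, Matrix.of_apply]
  refine Finset.sum_congr rfl fun i _ => ?_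
  rw [stateMoment_comm, hx.stateMoment_sum_left]
  congr 1
  refine Finset.sum_congr rfl fun j _ => ?_
  rw [stateMoment_comm, mul_comm]

theorem posSemidef_stateMoment (hx : IsStationaryColoredNoiseProcess P A Q τ x η W)
    (u : Fin n → PhaseSpace n →L[ℝ] ℝ) :
    (Matrix.of fun i j => stateMoment P x η (u i) (u j) 0 0).PosSemidef := by
  refine Matrix.PosSemidef.of_dotProduct_mulVec_nonneg ?_ fun c => ?_
  · ext i j
    rw [Matrix.conjTranspose_eq_transpose_of_trivial]
    exact stateMoment_comm _ _ _ _ _ _ _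
  · rw [star_trivial, hx.dotProduct_stateMoment_mulVec]
    exact integral_nonneg fun ω => mul_self_nonneg _

variable [IsProbabilityMeasure P]

/-- The moment identities give the fixed-point equation `M = τ (A M + S / (2τ))`, solved by the
resolvent. -/
theorem crossMoment_eq (hx : IsStationaryColoredNoiseProcess P A Q τ x η W) (hτ : 0 < τ)
    (hu : IsUnit (1 - τ • A)) :
    crossMoment P x η = (1 / 2 : ℝ) • (noiseResolvent τ A * CFC.sqrt ((2 : ℝ) • Q)) := by
  set M := crossMoment P x η with hM
  set S := CFC.sqrt ((2 : ℝ) • Q) with hS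
  have h : M = τ • (A * M + (1 / (2 * τ)) • S) := by
    ext i j
    refine (hx.stateMoment_pos_noise hτ i j).trans ?_
    rw [hx.stateMoment_drift_left]
    simp only [hx.stateMoment_noise_noise hτ, mul_ite, mul_zero, Finset.sum_ite_eq',
      Finset.mem_univ, if_true, Matrix.smul_apply, Matrix.add_apply, Matrix.mul_apply, smul_eq_mul,
      hM, crossMoment, Matrix.of_apply, ← hS]
    ring
  have h1 : (1 - τ • A) * M = (1 / 2 : ℝ) • S := by
    rw [sub_mul, one_mul, smul_mul_assoc]
    nth_rw 1 [h]
    rw [smul_add, smul_smul, add_sub_cancel_left]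
    congr 1
    field_simp
  rw [← mul_smul_comm, ← h1, ← mul_assoc, noiseResolvent,
    Matrix.nonsing_inv_mul _ ((Matrix.isUnit_iff_isUnit_det _).1 hu), one_mul]

theorem sqrt_mul_crossMoment_transpose (hx : IsStationaryColoredNoiseProcess P A Q τ x η W)
    (hτ : 0 < τ) (hQ : Q.PosDef) (hu : IsUnit (1 - τ • A)) :
    CFC.sqrt ((2 : ℝ) • Q) * (crossMoment P x η)ᵀ = Q * (noiseResolvent τ A)ᵀ := by
  rw [hx.crossMoment_eq hτ hu, Matrix.transpose_smul, Matrix.transpose_mul, sqrt_transpose,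
    mul_smul_comm, ← mul_assoc, sqrt_mul_sqrt hQ, smul_mul_assoc, smul_smul]
  norm_num

theorem crossMoment_mul_sqrt (hx : IsStationaryColoredNoiseProcess P A Q τ x η W)
    (hτ : 0 < τ) (hQ : Q.PosDef) (hu : IsUnit (1 - τ • A)) :
    crossMoment P x η * CFC.sqrt ((2 : ℝ) • Q) = noiseResolvent τ A * Q := by
  rw [hx.crossMoment_eq hτ hu, smul_mul_assoc, mul_assoc, sqrt_mul_sqrt hQ, mul_smul_comm,
    smul_smul]
  norm_num

theorem stateMoment_drift_pos (hx : IsStationaryColoredNoiseProcess P A Q τ x η W)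
    (hτ : 0 < τ) (hQ : Q.PosDef) (hu : IsUnit (1 - τ • A)) (i j : Fin n) {t : ℝ} (ht : 0 ≤ t) :
    stateMoment P x η (driftCoord A (CFC.sqrt ((2 : ℝ) • Q)) i) (posCoord j) t.toNNReal 0 =
      (A * twoTimeMoment P x t.toNNReal 0
        + Real.exp (-t / τ) • (Q * (noiseResolvent τ A)ᵀ)) i j := by
  rw [hx.stateMoment_drift_left, ← hx.sqrt_mul_crossMoment_transpose hτ hQ hu]
  simp only [hx.stateMoment_noise_zero _ _ ht, Matrix.add_apply, Matrix.smul_apply,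
    Matrix.mul_apply, smul_eq_mul, Finset.mul_sum]
  congr 1
  refine Finset.sum_congr rfl fun l _ => ?_
  rw [stateMoment_comm, Matrix.transpose_apply, crossMoment, Matrix.of_apply]
  ring

theorem stateMoment_drift_pos_zero (hx : IsStationaryColoredNoiseProcess P A Q τ x η W)
    (hτ : 0 < τ) (hQ : Q.PosDef) (hu : IsUnit (1 - τ • A)) (i j : Fin n) :
    stateMoment P x η (driftCoord A (CFC.sqrt ((2 : ℝ) • Q)) i) (posCoord j) 0 0 =
      (A * stationaryCov P x + Q * (noiseResolvent τ A)ᵀ) i j := by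
  have := hx.stateMoment_drift_pos hτ hQ hu i j le_rfl
  rwa [Real.toNNReal_zero, neg_zero, zero_div, Real.exp_zero, one_smul] at this

theorem hasMatrixDerivWithinAt_twoTimeMoment (hx : IsStationaryColoredNoiseProcess P A Q τ x η W)
    (hτ : 0 < τ) (hQ : Q.PosDef) (hu : IsUnit (1 - τ • A)) {t : ℝ} (ht : 0 ≤ t) :
    HasMatrixDerivWithinAt (fun s => twoTimeMoment P x s.toNNReal 0)
      (A * twoTimeMoment P x t.toNNReal 0 + Real.exp (-t / τ) • (Q * (noiseResolvent τ A)ᵀ))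
      (Set.Ici 0) t := by
  intro i j
  rw [← hx.stateMoment_drift_pos hτ hQ hu i j ht]
  exact hx.hasDerivWithinAt_stateMoment_pos i (posCoord j) ht

theorem fluctuationDissipation (hx : IsStationaryColoredNoiseProcess P A Q τ x η W)
    (hτ : 0 < τ) (hQ : Q.PosDef) (hu : IsUnit (1 - τ • A)) :
    FluctuationDissipation τ A Q (stationaryCov P x) := by
  have h : (A * stationaryCov P x + Q * (noiseResolvent τ A)ᵀ) +
      (A * stationaryCov P x + Q * (noiseResolvent τ A)ᵀ)ᵀ = 0 := by
    ext i j
    rw [Matrix.add_apply, Matrix.transpose_apply, ← hx.stateMoment_drift_pos_zero hτ hQ hu,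
      ← hx.stateMoment_drift_pos_zero hτ hQ hu, stateMoment_comm P x η (driftCoord _ _ j)]
    exact hx.stateMoment_drift_pos_add i j
  rw [FluctuationDissipation, ← h, Matrix.transpose_add, Matrix.transpose_mul,
    Matrix.transpose_mul, Matrix.transpose_transpose, hQ.transpose_eq, stationaryCov_transpose]
  abel

/-- Expanding `⟨(A x + S η)(A x + S η)ᵀ⟩` with the known moments identifies the matrix as a Gram
matrix. -/
theorem posSemidef_velocityCov (hx : IsStationaryColoredNoiseProcess P A Q τ x η W)
    (hτ : 0 < τ) (hQ : Q.PosDef) (hu : IsUnit (1 - τ • A)) :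
    (velocityCov τ A Q (stationaryCov P x)).PosSemidef := by
  set S := CFC.sqrt ((2 : ℝ) • Q) with hS
  have hGN : (Matrix.of fun i j => stateMoment P x η (driftCoord A S i) (noiseCoord j) 0 0) =
      A * crossMoment P x η + (1 / (2 * τ)) • S := by
    ext i j
    rw [Matrix.of_apply, hx.stateMoment_drift_left]
    simp only [hx.stateMoment_noise_noise hτ, mul_ite, mul_zero, Finset.sum_ite_eq',
      Finset.mem_univ, if_true, Matrix.smul_apply, Matrix.add_apply, Matrix.mul_apply, smul_eq_mul,
      crossMoment, Matrix.of_apply]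
    ring
  have hG : (Matrix.of fun i j => stateMoment P x η (driftCoord A S i) (driftCoord A S j) 0 0) =
      (A * stationaryCov P x + Q * (noiseResolvent τ A)ᵀ) * Aᵀ +
        (A * crossMoment P x η + (1 / (2 * τ)) • S) * Sᵀ := by
    rw [← hGN]
    ext i j
    rw [Matrix.of_apply, stateMoment_comm, hx.stateMoment_drift_left, Matrix.add_apply,
      Matrix.mul_apply, Matrix.mul_apply]
    congr 1
    · refine Finset.sum_congr rfl fun l _ => ?_
      rw [stateMoment_comm, hx.stateMoment_drift_pos_zero hτ hQ hu, mul_comm, Matrix.transpose_apply]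
    · refine Finset.sum_congr rfl fun l _ => ?_
      rw [stateMoment_comm, Matrix.of_apply, mul_comm, Matrix.transpose_apply]
  have e : velocityCov τ A Q (stationaryCov P x) =
      Matrix.of fun i j => stateMoment P x η (driftCoord A S i) (driftCoord A S j) 0 0 := by
    rw [hG, velocityCov, sqrt_transpose, add_mul, add_mul, mul_assoc A (crossMoment P x η),
      hx.crossMoment_mul_sqrt hτ hQ hu, smul_mul_assoc, hS, sqrt_mul_sqrt hQ, smul_smul]
    have : 1 / (2 * τ) * 2 = 1 / τ := by field_simp
    rw [this]
    abel
  rw [e]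
  exact hx.posSemidef_stateMoment _

/-- If `cᵀ x` vanishes almost surely, its moments with `η` vanish, so `Q Bᵀ c = 0`; both factors are
invertible. -/
theorem posDef_stationaryCov (hx : IsStationaryColoredNoiseProcess P A Q τ x η W)
    (hτ : 0 < τ) (hQ : Q.PosDef) (hu : IsUnit (1 - τ • A)) : (stationaryCov P x).PosDef := by
  have hCeq : stationaryCov P x =
      Matrix.of fun i j => stateMoment P x η (posCoord i) (posCoord j) 0 0 := rfl
  have hps : (stationaryCov P x).PosSemidef := hCeq ▸ hx.posSemidef_stateMoment posCoord
  refine Matrix.PosDef.of_dotProduct_mulVec_pos hps.isHermitian fun c hc =>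
    lt_of_le_of_ne (hps.dotProduct_mulVec_nonneg c) fun h0 => hc ?_
  rw [star_trivial, hCeq, hx.dotProduct_stateMoment_mulVec] at h0
  have hae : ∀ᵐ ω ∂P, (∑ l, c l • posCoord l : PhaseSpace n →L[ℝ] ℝ) (x 0 ω, η 0 ω) = 0 := by
    have := (integral_eq_zero_iff_of_nonneg (fun ω => mul_self_nonneg _)
      (hx.integrable_mul _ _ _ _)).1 h0.symm
    filter_upwards [this] with ω hω
    exact mul_self_eq_zero.1 hω
  have hM : (crossMoment P x η)ᵀ *ᵥ c = 0 := by
    funext j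
    have h1 : stateMoment P x η (∑ l, c l • posCoord l) (noiseCoord j) 0 0 = 0 :=
      integral_eq_zero_of_ae (by
        filter_upwards [hae] with ω hω
        rw [hω, zero_mul]
        rfl)
    rw [hx.stateMoment_sum_left] at h1
    rw [Pi.zero_apply, ← h1]
    simp only [Matrix.mulVec, dotProduct, Matrix.transpose_apply, crossMoment, Matrix.of_apply,
      mul_comm]
  have h2 : (Q * (noiseResolvent τ A)ᵀ) *ᵥ c = 0 := by
    rw [← hx.sqrt_mul_crossMoment_transpose hτ hQ hu, ← Matrix.mulVec_mulVec, hM,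
      Matrix.mulVec_zero]
  have hu' : IsUnit (Q * (noiseResolvent τ A)ᵀ) := by
    refine hQ.isUnit.mul ?_
    rw [Matrix.isUnit_transpose, noiseResolvent, Matrix.isUnit_nonsing_inv_iff]
    exact hu
  exact Matrix.mulVec_injective_of_isUnit hu' (h2.trans (Matrix.mulVec_zero _).symm)

end IsStationaryColoredNoiseProcess

/-! ### The main theorem -/

theorem mainTheorem1 {Ω : Type*} [MeasurableSpace Ω] (P : Measure Ω) [IsProbabilityMeasure P]
    {n : ℕ} (A Q : Matrix (Fin n) (Fin n) ℝ) (τ : ℝ) (hτ : 0 < τ)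
    (hA : IsHurwitz A) (hQ : Q.PosDef) (x η W : ℝ≥0 → Ω → Fin n → ℝ)
    (hx : IsStationaryColoredNoiseProcess P A Q τ x η W) :
    -- the resolvent is well defined, and the covariance and the correlation function do not
    -- depend on the base time
    IsUnit (1 - τ • A) ∧
    (∀ t, twoTimeMoment P x t t = stationaryCov P x) ∧
    (∀ s t : ℝ≥0, twoTimeMoment P x s t = correlation P x ((s : ℝ) - t)) ∧
    FluctuationDissipation τ A Q (stationaryCov P x) ∧
    -- `K' s`, `K'' s` are the first two derivatives of the correlation function at `s`;
    -- `Kr`, `Kl` are the right and left third derivatives at `0`, and `K₃` is their mean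
    ∃ (K' K'' : ℝ → Matrix (Fin n) (Fin n) ℝ) (Kr Kl K₃ : Matrix (Fin n) (Fin n) ℝ),
      (∀ s, HasMatrixDerivWithinAt (correlation P x) (K' s) Set.univ s) ∧
      (∀ s, HasMatrixDerivWithinAt K' (K'' s) Set.univ s) ∧
      HasMatrixDerivWithinAt K'' Kr (Set.Ici 0) 0 ∧
      HasMatrixDerivWithinAt K'' Kl (Set.Iic 0) 0 ∧
      K₃ = (1 / 2 : ℝ) • (Kr + Kl) ∧
      K' 0 = A * stationaryCov P x + Q * (noiseResolvent τ A)ᵀ ∧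
      K' 0 = (1 / 2 : ℝ) • (A * stationaryCov P x - stationaryCov P x * Aᵀ
        + Q * (noiseResolvent τ A)ᵀ - noiseResolvent τ A * Q) ∧
      SecondDerivRelation τ A (stationaryCov P x) (K' 0) (K'' 0) ∧
      ThirdDerivRelation τ A (stationaryCov P x) (K' 0) (K'' 0) K₃ ∧
      -- the three relations characterize `A` and `Q`
      (∀ A' Q' : Matrix (Fin n) (Fin n) ℝ,
        (FluctuationDissipation τ A' Q' (stationaryCov P x) ∧
          SecondDerivRelation τ A' (stationaryCov P x) (K' 0) (K'' 0) ∧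
          ThirdDerivRelation τ A' (stationaryCov P x) (K' 0) (K'' 0) K₃) ↔
        (A' = A ∧ Q' = Q)) ∧
      -- for negative definite `A` the first two suffice
      ((-A).PosDef → ∀ A' Q' : Matrix (Fin n) (Fin n) ℝ, A'.IsSymm →
        ((FluctuationDissipation τ A' Q' (stationaryCov P x) ∧
          SecondDerivRelation τ A' (stationaryCov P x) (K' 0) (K'' 0)) ↔
        (A' = A ∧ Q' = Q))) ∧
      -- the one-dimensional case
      (n = 1 → ∀ i : Fin n, K' 0 i i = 0 ∧ stationaryCov P x i i ≠ 0 ∧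
        K'' 0 i i / stationaryCov P x i i = A i i / τ) := by
  have hu := hA.isUnit_one_sub_smul hτ
  have hQs := hQ.transpose_eq
  have hC := hx.posDef_stationaryCov hτ hQ hu
  have hCs := hC.transpose_eq
  have hFDT := hx.fluctuationDissipation hτ hQ hu
  have hV := hx.posSemidef_velocityCov hτ hQ hu
  have hVs := hV.isHermitian
  rw [Matrix.IsHermitian, Matrix.conjTranspose_eq_transpose_of_trivial] at hVs
  refine ⟨hu, hx.twoTimeMoment_self, hx.twoTimeMoment_eq_correlation, hFDT, ?_⟩
  set C := stationaryCov P x with hCdef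
  set N := Q * (noiseResolvent τ A)ᵀ with hN
  have hk : (A * C + N)ᵀ = -(A * C + N) := hFDT.firstDeriv_transpose hCs hQs
  have hK2 : A * (A * C + N) - (1 / τ) • N = -velocityCov τ A Q C :=
    hFDT.secondDeriv_eq hτ hQs hu
  obtain ⟨hS, hT⟩ := hFDT.relations hτ hCs hQs hu hVs rfl rfl rfl
  rw [← hN] at hS hT
  set K₁ := fun s : ℝ => A * twoTimeMoment P x s.toNNReal 0 + Real.exp (-s / τ) • N with hK₁
  set K₂ := fun s : ℝ => A * K₁ s + (-(1 / τ) * Real.exp (-s / τ)) • N with hK₂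
  set K₃ := fun s : ℝ => A * K₂ s + ((1 / τ ^ 2) * Real.exp (-s / τ)) • N with hK₃
  have h10 : K₁ 0 = A * C + N := by simp [hK₁, hCdef, stationaryCov]
  have h20 : K₂ 0 = A * (A * C + N) - (1 / τ) • N := by
    simp [hK₂, h10, sub_eq_add_neg]
  have h30 : K₃ 0 = A * (A * (A * C + N) - (1 / τ) • N) + (1 / τ ^ 2) • N := by
    simp [hK₃, h20]
  have hexp : ∀ s, HasDerivAt (fun s => Real.exp (-s / τ)) (-(1 / τ) * Real.exp (-s / τ)) s := by
    intro s
    have := ((hasDerivAt_neg s).div_const τ).exp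
    rwa [mul_comm, neg_div τ 1] at this
  have hd0 : ∀ s, 0 ≤ s → HasMatrixDerivWithinAt (fun s => twoTimeMoment P x s.toNNReal 0) (K₁ s)
      (Set.Ici 0) s := fun s hs => hx.hasMatrixDerivWithinAt_twoTimeMoment hτ hQ hu hs
  have hd1 : ∀ s, 0 ≤ s → HasMatrixDerivWithinAt K₁ (K₂ s) (Set.Ici 0) s := fun s hs =>
    (hd0 s hs).mul_add_smul A N (hexp s).hasDerivWithinAt
  have hd2 : ∀ s, 0 ≤ s → HasMatrixDerivWithinAt K₂ (K₃ s) (Set.Ici 0) s := fun s hs => by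
    have := (hd1 s hs).mul_add_smul A N ((hexp s).const_mul (-(1 / τ))).hasDerivWithinAt
    have e : -(1 / τ) * (-(1 / τ) * Real.exp (-s / τ)) = 1 / τ ^ 2 * Real.exp (-s / τ) := by ring
    rwa [e] at this
  have h2s : (K₂ 0)ᵀ = K₂ 0 := by rw [h20, hK2, Matrix.transpose_neg, hVs]
  have hcor := correlation_eq_reflectExt P x
  -- Parities alternate along `K`, `K'`, `K''`. The one-sided third derivatives `K₃ 0` and `-(K₃
  -- 0)ᵀ` need not agree.
  refine ⟨reflectExt (-1) K₁, reflectExt 1 K₂, K₃ 0, -(K₃ 0)ᵀ, (1 / 2 : ℝ) • (K₃ 0 + -(K₃ 0)ᵀ),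
    ?_, ?_, hasMatrixDerivWithinAt_reflectExt_Ici 1 (hd2 0 le_rfl),
    hasMatrixDerivWithinAt_reflectExt_Iic (hd2 0 le_rfl) h2s, rfl, ?_⟩
  · rw [hcor]
    refine hasMatrixDerivWithinAt_reflectExt hd0 ?_ ?_
    · rw [one_smul, Real.toNNReal_zero]
      exact hCs.symm
    · rw [h10, hk, smul_neg, neg_smul, one_smul, neg_neg]
  · have := hasMatrixDerivWithinAt_reflectExt (ε := -1) hd1
      (by rw [h10, hk, smul_neg, neg_smul, one_smul, neg_neg])
      (by rw [neg_neg, one_smul, h2s])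
    rwa [neg_neg] at this
  rw [reflectExt_zero, reflectExt_zero, h10, h20, h30]
  have hF := posDef_add_transpose_of_antisymm hC hτ hk
  -- This matrix is `C / τ²` plus the velocity covariance.
  have hR : ((1 / τ ^ 2) • C - (A * (A * C + N) - (1 / τ) • N)).PosDef := by
    rw [hK2, sub_neg_eq_add]
    exact (hC.smul (by positivity)).add_posSemidef hV
  refine ⟨rfl, ?_, hS, hT, ?_, ?_, ?_⟩
  · have e : A * C + N = (1 / 2 : ℝ) • ((A * C + N) - (A * C + N)ᵀ) := by
      rw [hk]
      module
    conv_lhs => rw [e]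
    simp only [hN, Matrix.transpose_add, Matrix.transpose_mul, Matrix.transpose_transpose, hCs, hQs]
    congr 1
    abel
  · rintro A' Q'
    refine ⟨fun ⟨h0, h2, h3⟩ => ?_, ?_⟩
    · obtain rfl : A' = A := sub_eq_zero.1
        (hR.eq_zero_of_mul_eq_of_mul_add hF (hT.sub_mul_eq h3) (hS.sub_mul_add hCs h2))
      exact ⟨rfl, hFDT.eq_of_isHurwitz h0 hA hτ⟩
    · rintro ⟨rfl, rfl⟩
      exact ⟨hFDT, hS, hT⟩
  · intro hneg A' Q' hA's
    have hAs : Aᵀ = A := by simpa using hneg.transpose_eq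
    refine ⟨fun ⟨h0, h2⟩ => ?_, ?_⟩
    · have hD : (A' - A)ᵀ = A' - A := by rw [Matrix.transpose_sub, hA's.eq, hAs]
      have h4 := hS.sub_mul_add hCs h2
      rw [hD] at h4
      obtain rfl : A' = A := sub_eq_zero.1 (Matrix.IsSymm.eq_zero_of_mul_add hD hF h4)
      exact ⟨rfl, hFDT.eq_of_isHurwitz h0 hA hτ⟩
    · rintro ⟨rfl, rfl⟩
      exact ⟨hFDT, hS⟩
  · rintro rfl i
    -- An antisymmetric matrix has zero diagonal.
    have hki : (A * C + N) i i = 0 := by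
      have := congrFun (congrFun hk i) i
      rw [Matrix.transpose_apply, Matrix.neg_apply] at this
      linarith
    have hCi : C i i ≠ 0 := (hC.diag_pos (i := i)).ne'
    refine ⟨hki, hCi, ?_⟩
    obtain rfl : i = 0 := Subsingleton.elim _ _
    have h5 := congrFun (congrFun hS 0) 0
    rw [h5]
    generalize A * C + N = K at hki
    simp [Matrix.mul_apply, hki]
    field_simp
    ring
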